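/- Let $d,\eta,\delta,\rho>0$, $0<\theta\le 1$ and $p_0:\mathbb R\to(0,\infty)$. For a horizon $T>0$ consider the problem of minimizing $$\mathcal C(p,u)=\int_0^T\!\!\int_{\mathbb R}\frac{p_{x,t}^2+u_{x,t}^2}{2}e^{-\rho t}\,dx\,dt+\frac{1-\theta}{\theta}\int_{\mathbb R}\frac{p_{x,T}^2}{2}e^{-\rho T}\,dx\in[0,\infty]$$ over the admissible pairs $(p,u)$, that is, those satisfying $$\frac{\partial p}{\partial t}=d\,\frac{\partial^2p}{\partial x^2}+(\eta-\delta)p-\eta u\ \text{ on }\mathbb R\times(0,T),\qquad p_{x,0}=p_0(x),$$ where $p$ is a classical function (continuous on $\mathbb R\times[0,T]$, with $\partial_tp,\partial_xp,\partial_x^2p$ existing and continuous on $\mathbb R\times(0,T)$) such that $\int_0^T\int_{\mathbb R}|p_{x,t}|e^{-ax^2}\,dx\,dt<\infty$ for some $a>0$ (automatic when $\mathcal C(p,u)<\infty$). Let $(p,u)\ge 0$ be a globally optimal pair for the horizon $T$, let $u_{x,t}=p_{x,t}\tau_{x,t}$ on $\mathbb R\times[0,T]$, and let $\tau_{\min}$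 be the infimum of $\tau$ over $\mathbb R\times[0,T]$, assumed to be finite (the minimum, if it is attained). 1. Suppose that $\mathcal C(p,u)<\infty$, or that the integrals below converge for all $x\in\mathbb R$, $t\in(0,T]$. Then these integrals do converge for all $x\in\mathbb R$, $t\in(0,T]$; the function $$h_{x,t}=\frac{1}{2\sqrt{\pi dt}}\int_{-\infty}^{+\infty}e^{-\frac{(x-y)^2}{4dt}}p_0(y)\,dy\quad(t>0),\qquad h_{x,0}=p_0(x),$$ is a classical solution, in the same sense, of $\partial_th=d\,\partial_x^2h$ on $\mathbb R\times(0,T)$ with $h_{x,0}=p_0(x)$; and $$p_{x,t}\le e^{(\eta-\delta-\eta\tau_{\min})t}\,h_{x,t}\qquad\text{for all }x\in\mathbb R,\ t\in[0,T].$$ 2. For every $T>0$ let $(p^{T},u^{T})\ge0$ be such an optimal pair for the horizon $T$, all with the same $p_0$, and let $\tau^{T}$ and $\tau^{T}_{\min}$ be as above. (a) If the optimal costs $\mathcal C(p^T,u^T)$ are finite and $\tau^{T}_{\min}>\frac{\eta-\delta}{\eta}$ for all sufficiently large $T$, then $\lim_{T\to+\infty}p^{T}_{x,T}=0$ for every $x\in\mathbb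 R$. (b) If $\sup_{x\in\mathbb R}\int_x^{x+1}p_0(y)\,dy<\infty$ (for instance if $p_0$ is bounded), the costs being possibly infinite, and there is a constant $c>\frac{\eta-\delta}{\eta}$ with $\tau^{T}_{\min}\ge c$ for all sufficiently large $T$, then $\lim_{T\to+\infty}p^{T}_{x,T}=0$ for every $x\in\mathbb R$. -/

import Mathlib

open MeasureTheory Set Filter Topology

noncomputable section

/-- The partial derivative `∂f/∂t` at `(x, t)`. -/
def timeDeriv (f : ℝ → ℝ → ℝ) (x t : ℝ) : ℝ := deriv (fun s => f x s) t

/-- The partial derivative `∂f/∂x` at `(x, t)`. -/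
def spaceDeriv (f : ℝ → ℝ → ℝ) (x t : ℝ) : ℝ := deriv (fun y => f y t) x

/-- Classical regularity on the strip: `f` is continuous on `ℝ × [0, T]`, and on `ℝ × (0, T)` the
derivatives `∂f/∂t`, `∂f/∂x`, `∂²f/∂x²` exist and are jointly continuous. -/
structure IsClassical (T : ℝ) (f : ℝ → ℝ → ℝ) : Prop where
  cont : ContinuousOn (fun z : ℝ × ℝ => f z.1 z.2) (univ ×ˢ Icc 0 T)
  diff_time : ∀ x, ∀ t ∈ Ioo 0 T, DifferentiableAt ℝ (fun s => f x s) t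
  diff_space : ∀ x, ∀ t ∈ Ioo 0 T, DifferentiableAt ℝ (fun y => f y t) x
  diff_space_two : ∀ x, ∀ t ∈ Ioo 0 T, DifferentiableAt ℝ (fun y => spaceDeriv f y t) x
  cont_time : ContinuousOn (fun z : ℝ × ℝ => timeDeriv f z.1 z.2) (univ ×ˢ Ioo 0 T)
  cont_space : ContinuousOn (fun z : ℝ × ℝ => spaceDeriv f z.1 z.2) (univ ×ˢ Ioo 0 T)
  cont_space_two :
    ContinuousOn (fun z : ℝ × ℝ => spaceDeriv (spaceDeriv f) z.1 z.2) (univ ×ˢ Ioo 0 T)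

/-- The usual growth class for the heat equation on the whole line, in its integrated form:
`∫_0^T ∫_ℝ |f(x,t)| e^{-a x²} dx dt < ∞` for some `a > 0`. It contains every bounded `f`, every `f`
with `|f(x,t)| ≤ A e^{b x²}`, and every `f` that is square integrable on `ℝ × (0, T)`. -/
def GaussianGrowth (T : ℝ) (f : ℝ → ℝ → ℝ) : Prop :=
  ∃ a : ℝ, 0 < a ∧
    ∫⁻ t in Ioo 0 T, ∫⁻ x, ENNReal.ofReal (|f x t| * Real.exp (-a * x ^ 2)) < ⊤

/-- State `p` and control `u` satisfy the constraints of the control problem on `ℝ` with horizon `T`: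
`∂p/∂t = d ∂²p/∂x² + (η - δ) p - η u` on `ℝ × (0, T)` and `p(·, 0) = p0`. -/
structure IsAdmissible (d η δ T : ℝ) (p0 : ℝ → ℝ) (p u : ℝ → ℝ → ℝ) : Prop where
  classical : IsClassical T p
  growth : GaussianGrowth T p
  state_eq : ∀ x, ∀ t ∈ Ioo 0 T,
    timeDeriv p x t = d * spaceDeriv (spaceDeriv p) x t + (η - δ) * p x t - η * u x t
  initial : ∀ x, p x 0 = p0 x

/-- The social cost
`∫_0^T ∫_ℝ (p² + u²)/2 e^{-ρt} dx dt + (1-θ)/θ ∫_ℝ p(x,T)²/2 e^{-ρT} dx`, with values in `[0, ∞]`. -/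
def socialCost (ρ θ T : ℝ) (p u : ℝ → ℝ → ℝ) : ENNReal :=
  (∫⁻ t in Ioo 0 T, ∫⁻ x,
    ENNReal.ofReal ((p x t ^ 2 + u x t ^ 2) / 2 * Real.exp (-ρ * t)))
  + ∫⁻ x, ENNReal.ofReal ((1 - θ) / θ * (p x T ^ 2 / 2 * Real.exp (-ρ * T)))

/-- `(p, u)` is globally optimal: it minimizes the social cost among all admissible pairs. -/
structure IsOptimal (d η δ ρ θ T : ℝ) (p0 : ℝ → ℝ) (p u : ℝ → ℝ → ℝ) : Prop where
  admissible : IsAdmissible d η δ T p0 p u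
  minimal : ∀ q v : ℝ → ℝ → ℝ, IsAdmissible d η δ T p0 q v →
    socialCost ρ θ T p u ≤ socialCost ρ θ T q v

/-- `(p, u)` is a nonnegative globally optimal pair, `u = p τ` on `ℝ × [0, T]`, and `τmin` is the
infimum of the tax rate `τ` over `ℝ × [0, T]` (the minimum, if `τ` attains it). -/
structure IsOptimalWithTax (d η δ ρ θ T : ℝ) (p0 : ℝ → ℝ) (p u τ : ℝ → ℝ → ℝ) (τmin : ℝ) :
    Prop where
  optimal : IsOptimal d η δ ρ θ T p0 p u
  p_nonneg : ∀ x, ∀ t ∈ Icc 0 T, 0 ≤ p x t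
  u_nonneg : ∀ x, ∀ t ∈ Icc 0 T, 0 ≤ u x t
  tax : ∀ x, ∀ t ∈ Icc 0 T, u x t = p x t * τ x t
  tax_min : IsGLB ((fun z : ℝ × ℝ => τ z.1 z.2) '' (univ ×ˢ Icc 0 T)) τmin

/-- The Green integral `(1 / (2 √(π d t))) ∫ e^{-(x-y)²/(4dt)} p0(y) dy`, extended by `p0` at
`t = 0`. -/
def greenHeat (d : ℝ) (p0 : ℝ → ℝ) (x t : ℝ) : ℝ :=
  if t = 0 then p0 x
  else 1 / (2 * Real.sqrt (Real.pi * d * t)) *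
    ∫ y, Real.exp (-(x - y) ^ 2 / (4 * d * t)) * p0 y

/-- The Green integral of `p0` converges at every point of `ℝ × (0, T]`. -/
def GreenConverges (d T : ℝ) (p0 : ℝ → ℝ) : Prop :=
  ∀ x, ∀ t ∈ Ioc 0 T, Integrable (fun y => Real.exp (-(x - y) ^ 2 / (4 * d * t)) * p0 y)

/-- `h` is a classical solution of `∂h/∂t = d ∂²h/∂x²` on `ℝ × (0, T)` with `h(·, 0) = p0`. -/
structure IsHeatSolution (d T : ℝ) (p0 : ℝ → ℝ) (h : ℝ → ℝ → ℝ) : Prop where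
  classical : IsClassical T h
  heat_eq : ∀ x, ∀ t ∈ Ioo 0 T, timeDeriv h x t = d * spaceDeriv (spaceDeriv h) x t
  initial : ∀ x, h x 0 = p0 x

end

/-! Put `k = η - δ - η * τmin`. Since `p ≥ 0` and `τ ≥ τmin`, the state equation gives `∂p/∂t ≤ d
∂²p/∂x² + k p`. Hence `w = e^{-kt} p - h` is a subsolution of the heat equation with `w(·, 0) = 0`,
and the upper bound is the comparison principle `IsClassical.subsolution_nonpos` on the whole line.
Because `h ≥ 0`, the positive part of `w` is at most a multiple of `|p|`, so the growth condition on
`p` is enough.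

The comparison principle is an energy argument. The integral of a smoothed positive part of `w`
against `e^{-α(t) x²} χ(x / R)` is followed in time; `α` increases fast enough for its time
derivative to absorb the term `4 d α² x²` from the Laplacian. Only the derivatives of the cutoff
remain, and they cost `O(1/R)`. This works on time steps of a fixed length, which are iterated.

Convergence of the Green integral under finite cost is `IsAdmissible.integrable_initial`. There `p`
and `u` are square integrable in space-time, the weight `ψ = (1 + x²)^{-1/2}` is square integrable
with `|ψ''| ≤ c ψ`, and testing the state equation against `ψ` bounds `∫ p0 ψ`.

For the limits, the normalized heat kernel at time `t ≥ 1` is at most `C_x ψ(y)`, so under finite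
cost dominated convergence gives `h → 0` and an exponential factor `≤ 1` suffices. If `p0` has
bounded unit-interval integrals, then only `∫ p0 ψ² < ∞` is available and `h` is bounded by a linear
function of `t`; the uniform gap `c` supplies exponential decay that beats it. -/

/-! ### Integrals over functions of bounded support, and cutoffs -/

lemma continuousOn_integral_of_bounded_support {g : ℝ → ℝ → ℝ} {s : Set ℝ} {L : ℝ}
    (hg : ContinuousOn (fun z : ℝ × ℝ => g z.1 z.2) (univ ×ˢ s))
    (hs : ∀ x, L < |x| → ∀ t ∈ s, g x t = 0) :
    ContinuousOn (fun t => ∫ x, g x t) s := by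
  refine continuousOn_integral_of_compact_support (k := Icc (-L) L) isCompact_Icc ?_ ?_
  · exact hg.comp (f := fun z : ℝ × ℝ => (z.2, z.1)) (by fun_prop) (fun z hz => ⟨mem_univ _, hz.1⟩)
  · intro t x ht hx
    refine hs x ?_ t ht
    by_contra h
    exact hx (abs_le.1 (not_lt.1 h))

lemma continuous_slice {g : ℝ → ℝ → ℝ} {s : Set ℝ}
    (hg : ContinuousOn (fun z : ℝ × ℝ => g z.1 z.2) (univ ×ˢ s)) {t : ℝ} (ht : t ∈ s) :
    Continuous (fun x => g x t) := by
  rw [← continuousOn_univ]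
  exact hg.comp (f := fun x : ℝ => (x, t)) (by fun_prop) (fun z _ => ⟨mem_univ _, ht⟩)

lemma hasCompactSupport_of_abs {f : ℝ → ℝ} {L : ℝ} (h : ∀ x, L < |x| → f x = 0) :
    HasCompactSupport f := by
  refine HasCompactSupport.intro (K := Icc (-L) L) isCompact_Icc fun x hx => h x ?_
  by_contra h
  exact hx (abs_le.1 (not_lt.1 h))

lemma integrable_of_abs_support {f : ℝ → ℝ} {L : ℝ} (hf : Continuous f)
    (h : ∀ x, L < |x| → f x = 0) : Integrable f :=
  hf.integrable_of_hasCompactSupport (hasCompactSupport_of_abs h)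

lemma hasDerivAt_integral_of_bounded_support {g g' : ℝ → ℝ → ℝ} {a b L : ℝ}
    (hg : ContinuousOn (fun z : ℝ × ℝ => g z.1 z.2) (univ ×ˢ Ioo a b))
    (hg' : ContinuousOn (fun z : ℝ × ℝ => g' z.1 z.2) (univ ×ˢ Ioo a b))
    (hd : ∀ x, ∀ t ∈ Ioo a b, HasDerivAt (fun s => g x s) (g' x t) t)
    (hs : ∀ x, L < |x| → ∀ t ∈ Ioo a b, g x t = 0)
    (hs' : ∀ x, L < |x| → ∀ t ∈ Ioo a b, g' x t = 0) {t : ℝ} (ht : t ∈ Ioo a b) :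
    HasDerivAt (fun t => ∫ x, g x t) (∫ x, g' x t) t := by
  obtain ⟨r, hr, hrs⟩ := Metric.nhds_basis_closedBall.mem_iff.1 (Ioo_mem_nhds ht.1 ht.2)
  have hK : IsCompact (Icc (-L) L ×ˢ Metric.closedBall t r) :=
    isCompact_Icc.prod (isCompact_closedBall _ _)
  obtain ⟨C, hC⟩ := hK.exists_bound_of_continuousOn
    (hg'.mono (prod_mono (subset_univ _) hrs))
  refine (hasDerivAt_integral_of_dominated_loc_of_deriv_le (F := fun t x => g x t)
    (F' := fun t x => g' x t) (bound := (Icc (-L) L).indicator fun _ => C)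
    (Metric.closedBall_mem_nhds t hr) ?_ ?_ ?_ ?_ ?_ ?_).2
  · filter_upwards [Ioo_mem_nhds ht.1 ht.2] with s hs
    exact (continuous_slice hg hs).aestronglyMeasurable
  · exact integrable_of_abs_support (continuous_slice hg ht) (fun x hx => hs x hx t ht)
  · exact (continuous_slice hg' ht).aestronglyMeasurable
  · refine Eventually.of_forall fun x s hsr => ?_
    by_cases hx : x ∈ Icc (-L) L
    · rw [indicator_of_mem hx]
      exact hC (x, s) ⟨hx, hsr⟩
    · rw [indicator_of_notMem hx, hs' x _ s (hrs hsr), norm_zero]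
      by_contra h
      exact hx (abs_le.1 (not_lt.1 h))
  · exact (integrable_indicator_iff measurableSet_Icc).2 (by simp)
  · exact Eventually.of_forall fun x s hsr => hd x s (hrs hsr)

/-- The bounded support of `φ` removes all boundary terms, so `v` may be arbitrary at infinity. -/
lemma integral_deriv_two_mul {v v' v'' φ φ' φ'' : ℝ → ℝ} {L : ℝ}
    (hv : ∀ x, HasDerivAt v (v' x) x) (hv' : ∀ x, HasDerivAt v' (v'' x) x) (hv'' : Continuous v'')
    (hφ : ∀ x, HasDerivAt φ (φ' x) x) (hφ' : ∀ x, HasDerivAt φ' (φ'' x) x)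
    (hφ'' : Continuous φ'') (h0 : ∀ x, L < |x| → φ x = 0) (h0' : ∀ x, L < |x| → φ' x = 0)
    (h0'' : ∀ x, L < |x| → φ'' x = 0) :
    ∫ x, v'' x * φ x = ∫ x, v x * φ'' x := by
  have cv : Continuous v := continuous_iff_continuousAt.2 fun x => (hv x).continuousAt
  have cv' : Continuous v' := continuous_iff_continuousAt.2 fun x => (hv' x).continuousAt
  have cφ : Continuous φ := continuous_iff_continuousAt.2 fun x => (hφ x).continuousAt
  have cφ' : Continuous φ' := continuous_iff_continuousAt.2 fun x => (hφ' x).continuousAt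
  have key : ∀ {f g : ℝ → ℝ}, Continuous f → Continuous g → (∀ x, L < |x| → g x = 0) →
      Integrable (f * g) := fun hf hg h =>
    integrable_of_abs_support (L := L) (hf.mul hg) fun x hx => by simp [h x hx]
  have h1 := integral_mul_deriv_eq_deriv_mul_of_integrable (u := v) (v := φ')
    (fun x _ => hv x) (fun x _ => hφ' x) (key cv hφ'' h0'') (key cv' cφ' h0') (key cv cφ' h0')
  have h2 := integral_mul_deriv_eq_deriv_mul_of_integrable (u := v') (v := φ)
    (fun x _ => hv' x) (fun x _ => hφ x) (key cv' cφ' h0') (key hv'' cφ h0) (key cv' cφ h0)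
  rw [h1, h2, neg_neg]

/-- Smooth cutoffs: `χ R = 1` on `[-R, R]`, `χ R = 0` off `[-2R, 2R]`, derivatives `O(1 / R)`. -/
lemma exists_cutoff : ∃ (C : ℝ) (χ χ' χ'' : ℝ → ℝ → ℝ), 0 ≤ C ∧ ∀ R, 1 ≤ R →
    (∀ x, HasDerivAt (χ R) (χ' R x) x) ∧ (∀ x, HasDerivAt (χ' R) (χ'' R x) x) ∧
    Continuous (χ'' R) ∧ (∀ x, 0 ≤ χ R x) ∧ (∀ x, χ R x ≤ 1) ∧ (∀ x, |x| ≤ R → χ R x = 1) ∧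
    (∀ x, 2 * R < |x| → χ R x = 0) ∧ (∀ x, 2 * R < |x| → χ' R x = 0) ∧
    (∀ x, 2 * R < |x| → χ'' R x = 0) ∧ (∀ x, |χ' R x| ≤ C / R) ∧ (∀ x, |χ'' R x| ≤ C / R) := by
  let f : ContDiffBump (0 : ℝ) := ⟨1, 2, by norm_num, by norm_num⟩
  have hf : ContDiff ℝ 2 f := f.contDiff
  have hf' : ContDiff ℝ 1 (deriv f) := ContDiff.deriv' (n := 1) (by exact_mod_cast hf)
  have hf'' : Continuous (deriv (deriv f)) := hf'.continuous_deriv le_rfl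
  have d1 : ∀ x, HasDerivAt f (deriv f x) x := fun x =>
    (hf.differentiable (by norm_num) x).hasDerivAt
  have d2 : ∀ x, HasDerivAt (deriv f) (deriv (deriv f) x) x := fun x =>
    (hf'.differentiable (by norm_num) x).hasDerivAt
  obtain ⟨C1, hC1⟩ := f.hasCompactSupport.deriv.exists_bound_of_continuous hf'.continuous
  obtain ⟨C2, hC2⟩ := f.hasCompactSupport.deriv.deriv.exists_bound_of_continuous hf''
  have h0 : ∀ x, 2 < |x| → f =ᶠ[𝓝 x] fun _ => 0 := fun x hx => by
    filter_upwards [(isOpen_lt continuous_const continuous_abs).mem_nhds hx] with y hy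
    apply f.zero_of_le_dist
    simpa using (le_of_lt hy : (2 : ℝ) ≤ |y|)
  have h0' : ∀ x, 2 < |x| → deriv f =ᶠ[𝓝 x] fun _ => 0 := fun x hx => by
    simpa using (h0 x hx).deriv
  have h0'' : ∀ x, 2 < |x| → deriv (deriv f) =ᶠ[𝓝 x] fun _ => 0 := fun x hx => by
    simpa using (h0' x hx).deriv
  refine ⟨max C1 C2, fun R x => f (x / R), fun R x => deriv f (x / R) / R,
    fun R x => deriv (deriv f) (x / R) / R / R, le_max_of_le_left ((norm_nonneg _).trans (hC1 0)),
    fun R hR => ?_⟩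
  have hR0 : 0 < R := by linarith
  have sc : ∀ x, 2 * R < |x| → 2 < |x / R| := fun x hx => by
    rw [abs_div, abs_of_pos hR0, lt_div_iff₀ hR0]; exact hx
  refine ⟨fun x => ?_, fun x => ?_, by fun_prop, fun x => f.nonneg, fun x => f.le_one,
    fun x hx => ?_, fun x hx => (h0 _ (sc x hx)).eq_of_nhds,
    fun x hx => by simp [(h0' _ (sc x hx)).eq_of_nhds],
    fun x hx => by simp [(h0'' _ (sc x hx)).eq_of_nhds], fun x => ?_, fun x => ?_⟩
  · have := (d1 (x / R)).comp x ((hasDerivAt_id x).div_const R)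
    exact this.congr_deriv (mul_one_div _ _)
  · have := ((d2 (x / R)).comp x ((hasDerivAt_id x).div_const R)).div_const R
    exact this.congr_deriv (congrArg (· / R) (mul_one_div _ _))
  · apply f.one_of_mem_closedBall
    simp only [Metric.mem_closedBall, dist_zero_right, Real.norm_eq_abs, abs_div, abs_of_pos hR0]
    exact (div_le_one hR0).2 hx
  · rw [abs_div, abs_of_pos hR0]
    gcongr
    exact (hC1 _).trans (le_max_left _ _)
  · rw [abs_div, abs_div, abs_of_pos hR0]
    -- The second derivative is really `O(1 / R²)`; `R ≥ 1` weakens it to the common bound `C / R`.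
    have : |deriv (deriv f) (x / R)| / R ≤ |deriv (deriv f) (x / R)| :=
      div_le_self (abs_nonneg _) hR
    gcongr
    exact this.trans ((hC2 _).trans (le_max_right _ _))

/-- The norm of a Bochner integral is at most the lower integral of the norm, with value `0` for
non-integrable functions. Hence no measurability or integrability of `g` is required. -/
lemma ofReal_intervalIntegral_integral_le {g : ℝ → ℝ → ℝ} {s t T : ℝ} (hs : 0 ≤ s) (hst : s ≤ t)
    (ht : t < T) (hg : ∀ x, ∀ τ ∈ Ioo 0 T, 0 ≤ g x τ) :
    ENNReal.ofReal (∫ τ in s..t, ∫ x, g x τ)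
      ≤ ∫⁻ τ in Ioo 0 T, ∫⁻ x, ENNReal.ofReal (g x τ) := by
  rw [intervalIntegral.integral_of_le hst]
  refine (Real.ofReal_le_enorm _).trans ((enorm_integral_le_lintegral_enorm _).trans ?_)
  have hsub : Ioc s t ⊆ Ioo 0 T := fun τ hτ => ⟨hs.trans_lt hτ.1, hτ.2.trans_lt ht⟩
  refine (lintegral_mono_set hsub).trans ?_
  refine setLIntegral_mono' measurableSet_Ioo fun τ hτ => ?_
  refine (enorm_integral_le_lintegral_enorm _).trans (lintegral_mono fun x => ?_)
  rw [Real.enorm_of_nonneg (hg x τ hτ)]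

/-! ### Comparison principle for the heat equation on the line -/

noncomputable section

/-- A `C²` convex function that vanishes on `(-∞, 0]`, is positive on `(0, ∞)` and lies below
the positive part. -/
def softPos (s : ℝ) : ℝ := max s 0 - Real.arctan (max s 0)

/-- The derivative of `softPos`. -/
def softPosDeriv (s : ℝ) : ℝ := max s 0 ^ 2 / (1 + max s 0 ^ 2)

/-- The second derivative of `softPos`. -/
def softPosDerivTwo (s : ℝ) : ℝ := 2 * max s 0 / (1 + max s 0 ^ 2) ^ 2

end

lemma softPos_of_nonpos {s : ℝ} (h : s ≤ 0) : softPos s = 0 := by simp [softPos, h]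

lemma continuous_softPos : Continuous softPos := by unfold softPos; fun_prop

lemma continuous_softPosDeriv : Continuous softPosDeriv := by
  unfold softPosDeriv
  exact Continuous.div (by fun_prop) (by fun_prop) fun x => by positivity

lemma continuous_softPosDerivTwo : Continuous softPosDerivTwo := by
  unfold softPosDerivTwo
  exact Continuous.div (by fun_prop) (by fun_prop) fun x => by positivity

lemma softPosDeriv_nonneg (s : ℝ) : 0 ≤ softPosDeriv s := by unfold softPosDeriv; positivity

lemma softPosDerivTwo_nonneg (s : ℝ) : 0 ≤ softPosDerivTwo s := by
  have : 0 ≤ max s 0 := le_max_right _ _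
  unfold softPosDerivTwo; positivity

lemma hasDerivAt_softPos (s : ℝ) : HasDerivAt softPos (softPosDeriv s) s := by
  -- At the gluing point `0` the derivative is obtained as a limit: function and candidate
  -- derivative are continuous there, and the formula holds on both sides.
  refine hasDerivAt_of_hasDerivAt_of_ne' (x := 0) (fun y hy => ?_)
    continuous_softPos.continuousAt continuous_softPosDeriv.continuousAt s
  rcases lt_or_gt_of_ne hy with hy | hy
  · have h : softPos =ᶠ[𝓝 y] fun _ => 0 := by
      filter_upwards [gt_mem_nhds hy] with z hz using softPos_of_nonpos hz.le
    refine ((hasDerivAt_const y (0 : ℝ)).congr_of_eventuallyEq h).congr_deriv ?_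
    simp [softPosDeriv, hy.le]
  · have h : softPos =ᶠ[𝓝 y] fun z => z - Real.arctan z := by
      filter_upwards [lt_mem_nhds hy] with z hz
      simp [softPos, max_eq_left hz.le]
    refine (((hasDerivAt_id y).sub (Real.hasDerivAt_arctan y)).congr_of_eventuallyEq
      h).congr_deriv ?_
    have : 1 + y ^ 2 ≠ 0 := by positivity
    simp only [softPosDeriv, max_eq_left hy.le]
    field_simp
    ring

lemma hasDerivAt_softPosDeriv (s : ℝ) : HasDerivAt softPosDeriv (softPosDerivTwo s) s := by
  refine hasDerivAt_of_hasDerivAt_of_ne' (x := 0) (fun y hy => ?_)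
    continuous_softPosDeriv.continuousAt continuous_softPosDerivTwo.continuousAt s
  rcases lt_or_gt_of_ne hy with hy | hy
  · have h : softPosDeriv =ᶠ[𝓝 y] fun _ => 0 := by
      filter_upwards [gt_mem_nhds hy] with z hz
      simp [softPosDeriv, max_eq_right (le_of_lt hz)]
    refine ((hasDerivAt_const y (0 : ℝ)).congr_of_eventuallyEq h).congr_deriv ?_
    simp [softPosDerivTwo, hy.le]
  · have h : softPosDeriv =ᶠ[𝓝 y] fun z => z ^ 2 / (1 + z ^ 2) := by
      filter_upwards [lt_mem_nhds hy] with z hz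
      simp [softPosDeriv, max_eq_left (le_of_lt hz)]
    have h1 : HasDerivAt (fun z : ℝ => z ^ 2) (2 * y) y := by simpa using hasDerivAt_pow 2 y
    have : 1 + y ^ 2 ≠ 0 := by positivity
    refine ((h1.div (h1.const_add 1) this).congr_of_eventuallyEq h).congr_deriv ?_
    simp only [softPosDerivTwo, max_eq_left hy.le]
    field_simp
    ring

lemma softPos_pos {s : ℝ} (h : 0 < s) : 0 < softPos s := by
  simp only [softPos, max_eq_left h.le, sub_pos]
  simpa using Real.lt_tan (Real.arctan_pos.2 h) (Real.arctan_lt_pi_div_two s)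

lemma softPos_nonneg (s : ℝ) : 0 ≤ softPos s := by
  rcases le_or_gt s 0 with h | h
  · exact (softPos_of_nonpos h).ge
  · exact (softPos_pos h).le

lemma softPos_le (s : ℝ) : softPos s ≤ max s 0 := by
  have : 0 ≤ Real.arctan (max s 0) := Real.arctan_nonneg.2 (le_max_right _ _)
  simp only [softPos]; linarith

/-- Absorbs the factor `x` from the derivative of a Gaussian at the price of a slightly wider
Gaussian. -/
lemma abs_le_mul_exp {a : ℝ} (ha : 0 < a) (x : ℝ) :
    |x| ≤ (1 + 1 / a) * Real.exp (a * x ^ 2) := by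
  have h1 : a * x ^ 2 + 1 ≤ Real.exp (a * x ^ 2) := Real.add_one_le_exp _
  have h2 : |x| ≤ 1 + x ^ 2 := by
    rw [← sq_abs x]; nlinarith [sq_nonneg (|x| - 1), abs_nonneg x]
  have h3 : 1 + x ^ 2 ≤ (1 + 1 / a) * (a * x ^ 2 + 1) := by
    have : (1 + 1 / a) * (a * x ^ 2 + 1) = a * x ^ 2 + 1 + x ^ 2 + 1 / a := by field_simp; ring
    rw [this]
    have : 0 ≤ a * x ^ 2 := by positivity
    have : 0 < 1 / a := by positivity
    linarith
  calc |x| ≤ _ := h2.trans h3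
    _ ≤ _ := by gcongr

/-- Kato-type inequality: integrating by parts against a nonnegative test function, the convexity
term of `softPos` has a sign and can be dropped. -/
lemma integral_softPosDeriv_mul_le {v v' v'' φ φ' φ'' : ℝ → ℝ} {L : ℝ}
    (hv : ∀ x, HasDerivAt v (v' x) x) (hv' : ∀ x, HasDerivAt v' (v'' x) x) (hv'' : Continuous v'')
    (hφ : ∀ x, HasDerivAt φ (φ' x) x) (hφ' : ∀ x, HasDerivAt φ' (φ'' x) x)
    (hφ'' : Continuous φ'') (h0 : ∀ x, L < |x| → φ x = 0) (h0' : ∀ x, L < |x| → φ' x = 0)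
    (h0'' : ∀ x, L < |x| → φ'' x = 0) (hpos : ∀ x, 0 ≤ φ x) :
    ∫ x, softPosDeriv (v x) * v'' x * φ x ≤ ∫ x, softPos (v x) * φ'' x := by
  have cv : Continuous v := continuous_iff_continuousAt.2 fun x => (hv x).continuousAt
  have cv' : Continuous v' := continuous_iff_continuousAt.2 fun x => (hv' x).continuousAt
  have cφ : Continuous φ := continuous_iff_continuousAt.2 fun x => (hφ x).continuousAt
  have c1 := continuous_softPosDeriv.comp cv
  have c2 := continuous_softPosDerivTwo.comp cv
  have cW : Continuous fun x => softPosDerivTwo (v x) * v' x ^ 2 + softPosDeriv (v x) * v'' x :=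
    (c2.mul (cv'.pow 2)).add (c1.mul hv'')
  rw [← integral_deriv_two_mul (v := fun x => softPos (v x))
    (v' := fun x => softPosDeriv (v x) * v' x)
    (v'' := fun x => softPosDerivTwo (v x) * v' x ^ 2 + softPosDeriv (v x) * v'' x)
    (fun x => (hasDerivAt_softPos (v x)).comp x (hv x))
    (fun x => (((hasDerivAt_softPosDeriv (v x)).comp x (hv x)).mul (hv' x)).congr_deriv
      (by simp only [Function.comp_apply]; ring)) cW hφ hφ' hφ'' h0 h0' h0'']
  refine integral_mono ?_ ?_ fun x => ?_
  · exact integrable_of_abs_support (L := L) ((c1.mul hv'').mul cφ) fun x hx => by simp [h0 x hx]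
  · exact integrable_of_abs_support (L := L) (cW.mul cφ) fun x hx => by simp [h0 x hx]
  · have := softPosDerivTwo_nonneg (v x)
    have := hpos x
    simp only
    gcongr
    have : 0 ≤ softPosDerivTwo (v x) * v' x ^ 2 := by positivity
    linarith

/-- The left side is `d φ_xx + φ_t` for `φ = e^{-α(t) x²} χ` with `α' = 64 d a²`. As `α ≤ 4a`, the
time derivative dominates `4 d α² x²`, so the terms carrying `χ` itself are nonpositive. The others
contain `χ'` or `χ''`, and `α ≥ 2a` leaves room to absorb `x` and still keep `e^{-a x²}`. The
constant is `16 (a + 1) + 1`. -/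
lemma gaussian_test_bound {d a C R α x χ χ' χ'' : ℝ} (hd : 0 < d) (ha : 0 < a) (hC : 0 ≤ C)
    (hR : 0 < R) (hα : 2 * a ≤ α) (hα' : α ≤ 4 * a) (h0 : 0 ≤ χ) (h1 : |χ'| ≤ C / R)
    (h2 : |χ''| ≤ C / R) :
    d * ((4 * α ^ 2 * x ^ 2 - 2 * α) * Real.exp (-α * x ^ 2) * χ
        + 2 * (-2 * α * x * Real.exp (-α * x ^ 2)) * χ' + Real.exp (-α * x ^ 2) * χ'')
      + -(64 * d * a ^ 2 * x ^ 2) * Real.exp (-α * x ^ 2) * χ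
      ≤ d * C * (16 * a + 17) / R * Real.exp (-a * x ^ 2) := by
  set e := Real.exp (-α * x ^ 2) with he
  have he0 : 0 < e := Real.exp_pos _
  have hα0 : 0 < α := by linarith
  have hCR : 0 ≤ C / R := by positivity
  have hee : e * Real.exp (a * x ^ 2) ≤ Real.exp (-a * x ^ 2) := by
    rw [he, ← Real.exp_add]
    apply Real.exp_le_exp.2
    nlinarith [sq_nonneg x]
  have hee' : e ≤ e * Real.exp (a * x ^ 2) :=
    le_mul_of_one_le_right he0.le (Real.one_le_exp (by positivity))
  have hx := abs_le_mul_exp ha x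
  have t1 : d * ((4 * α ^ 2 * x ^ 2 - 2 * α) * e * χ) + -(64 * d * a ^ 2 * x ^ 2) * e * χ ≤ 0 := by
    have : d * ((4 * α ^ 2 * x ^ 2 - 2 * α) * e * χ) + -(64 * d * a ^ 2 * x ^ 2) * e * χ
        = -(d * ((64 * a ^ 2 - 4 * α ^ 2) * x ^ 2 + 2 * α) * e * χ) := by ring
    rw [this, neg_nonpos]
    have : 0 ≤ 64 * a ^ 2 - 4 * α ^ 2 := by nlinarith
    positivity
  have t2 : 2 * (-2 * α * x * e) * χ' ≤ 16 * (a + 1) * (C / R) * Real.exp (-a * x ^ 2) := by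
    calc 2 * (-2 * α * x * e) * χ' ≤ |2 * (-2 * α * x * e) * χ'| := le_abs_self _
      _ = 4 * α * |x| * e * |χ'| := by
        simp only [abs_mul, abs_of_pos hα0, abs_of_pos he0, abs_neg, abs_two]; ring
      _ ≤ 4 * (4 * a) * ((1 + 1 / a) * Real.exp (a * x ^ 2)) * e * (C / R) := by gcongr
      _ = 16 * (a + 1) * (C / R) * (e * Real.exp (a * x ^ 2)) := by field_simp; ring
      _ ≤ _ := by gcongr
  have t3 : e * χ'' ≤ (C / R) * Real.exp (-a * x ^ 2) := by
    calc e * χ'' ≤ e * (C / R) := by gcongr; exact (le_abs_self _).trans h2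
      _ ≤ Real.exp (-a * x ^ 2) * (C / R) := by gcongr; exact hee'.trans hee
      _ = _ := mul_comm _ _
  have : d * C * (16 * a + 17) / R * Real.exp (-a * x ^ 2)
      = d * (16 * (a + 1) * (C / R) * Real.exp (-a * x ^ 2)
        + (C / R) * Real.exp (-a * x ^ 2)) := by ring
  rw [this]
  have := mul_le_mul_of_nonneg_left (add_le_add t2 t3) hd.le
  linarith

/-- Localized energy estimate for the positive part of a subsolution of the heat equation. -/
lemma IsClassical.softPos_energy_le {d a T K t₀ t₁ : ℝ} {w : ℝ → ℝ → ℝ} (hd : 0 < d) (ha : 0 < a)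
    (hcl : IsClassical T w)
    (hsub : ∀ x, ∀ t ∈ Ioo 0 T, timeDeriv w x t ≤ d * spaceDeriv (spaceDeriv w) x t)
    (hK : ∫⁻ t in Ioo 0 T, ∫⁻ x, ENNReal.ofReal (max (w x t) 0 * Real.exp (-a * x ^ 2))
      ≤ ENNReal.ofReal K) (hK0 : 0 ≤ K)
    (ht₀ : 0 ≤ t₀) (h01 : t₀ ≤ t₁) (ht₁ : t₁ < T) (hlen : 32 * d * a * (t₁ - t₀) ≤ 1)
    (hinit : ∀ x, w x t₀ ≤ 0) {C : ℝ} (hC : 0 ≤ C) {R : ℝ} (hR : 0 < R)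
    {χ χ' χ'' ξ : ℝ → ℝ} (c1 : ∀ x, HasDerivAt χ (χ' x) x) (c2 : ∀ x, HasDerivAt χ' (χ'' x) x)
    (c3 : Continuous χ'') (c4 : ∀ x, 0 ≤ χ x)
    (c5 : ∀ x, 2 * R < |x| → χ x = 0) (c6 : ∀ x, 2 * R < |x| → χ' x = 0)
    (c7 : ∀ x, 2 * R < |x| → χ'' x = 0) (c8 : ∀ x, |χ' x| ≤ C / R) (c9 : ∀ x, |χ'' x| ≤ C / R)
    (x1 : Continuous ξ) (x2 : ∀ x, 0 ≤ ξ x) (x3 : ∀ x, ξ x ≤ 1) (x4 : ∀ x, |x| ≤ 2 * R → ξ x = 1)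
    (x5 : ∀ x, 4 * R < |x| → ξ x = 0) :
    ∫ x, softPos (w x t₁) * (Real.exp (-(2 * a + 64 * d * a ^ 2 * (t₁ - t₀)) * x ^ 2) * χ x)
      ≤ d * C * (16 * a + 17) / R * K := by
  set α : ℝ → ℝ := fun t => 2 * a + 64 * d * a ^ 2 * (t - t₀) with hα
  have cα : Continuous α := by fun_prop
  have cχ : Continuous χ := continuous_iff_continuousAt.2 fun x => (c1 x).continuousAt
  have cχ' : Continuous χ' := continuous_iff_continuousAt.2 fun x => (c2 x).continuousAt
  have hIoo : Ioo t₀ t₁ ⊆ Ioo 0 T := fun t ht => ⟨ht₀.trans_lt ht.1, ht.2.trans ht₁⟩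
  have hIcc : Icc t₀ t₁ ⊆ Icc 0 T := Icc_subset_Icc ht₀ ht₁.le
  have cw : ContinuousOn (fun z : ℝ × ℝ => w z.1 z.2) (univ ×ˢ Icc t₀ t₁) :=
    hcl.cont.mono (prod_mono_right hIcc)
  have cW : ContinuousOn (fun z : ℝ × ℝ => softPos (w z.1 z.2)) (univ ×ˢ Icc t₀ t₁) :=
    continuous_softPos.comp_continuousOn cw
  have cW' : ContinuousOn (fun z : ℝ × ℝ => softPos (w z.1 z.2)) (univ ×ˢ Ioo t₀ t₁) :=
    cW.mono (prod_mono_right Ioo_subset_Icc_self)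
  have cwt : ContinuousOn (fun z : ℝ × ℝ => timeDeriv w z.1 z.2) (univ ×ˢ Ioo t₀ t₁) :=
    hcl.cont_time.mono (prod_mono_right hIoo)
  have cD : ContinuousOn (fun z : ℝ × ℝ => softPosDeriv (w z.1 z.2)) (univ ×ˢ Ioo t₀ t₁) :=
    continuous_softPosDeriv.comp_continuousOn (cw.mono (prod_mono_right Ioo_subset_Icc_self))
  set D := d * C * (16 * a + 17) / R with hD
  have hD0 : 0 ≤ D := by positivity
  -- The wider cutoff `ξ` is `1` wherever `χ` lives. It keeps the majorant of bounded support, so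
  -- that its space integral is continuous in `t`, while `hK` still bounds it independently of `R`.
  set G : ℝ → ℝ → ℝ := fun x t => softPos (w x t) * (Real.exp (-a * x ^ 2) * ξ x) with hG
  have cG : ContinuousOn (fun z : ℝ × ℝ => G z.1 z.2) (univ ×ˢ Icc t₀ t₁) :=
    cW.mul (Continuous.continuousOn (by fun_prop))
  have cGi : ContinuousOn (fun t => ∫ x, G x t) (Icc t₀ t₁) :=
    continuousOn_integral_of_bounded_support (L := 4 * R) cG fun x hx t _ => by simp [hG, x5 x hx]
  have hGle : ∫ t in t₀..t₁, ∫ x, G x t ≤ K := by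
    have hG0 : ∀ x t, 0 ≤ G x t := fun x t =>
      mul_nonneg (softPos_nonneg _) (mul_nonneg (Real.exp_nonneg _) (x2 x))
    have := (ofReal_intervalIntegral_integral_le ht₀ h01 ht₁ fun x t _ => hG0 x t).trans
      ((lintegral_mono fun t => lintegral_mono fun x => ENNReal.ofReal_le_ofReal ?_).trans hK)
    · exact (ENNReal.ofReal_le_ofReal_iff hK0).1 this
    · calc softPos (w x t) * (Real.exp (-a * x ^ 2) * ξ x)
          ≤ max (w x t) 0 * (Real.exp (-a * x ^ 2) * 1) := by
            have := softPos_le (w x t)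
            have := x3 x
            have := x2 x
            have : 0 ≤ max (w x t) 0 := le_max_right _ _
            gcongr
        _ = _ := by rw [mul_one]
  -- The test function, followed by its derivatives in `x`, `xx` and `t`.
  set Ψ : ℝ → ℝ → ℝ := fun x t => Real.exp (-α t * x ^ 2) * χ x with hΨ
  set Ψx : ℝ → ℝ → ℝ := fun x t => -2 * α t * x * Real.exp (-α t * x ^ 2) * χ x
    + Real.exp (-α t * x ^ 2) * χ' x with hΨx
  set Ψxx : ℝ → ℝ → ℝ := fun x t => (4 * α t ^ 2 * x ^ 2 - 2 * α t) * Real.exp (-α t * x ^ 2) * χ x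
    + 2 * (-2 * α t * x * Real.exp (-α t * x ^ 2)) * χ' x + Real.exp (-α t * x ^ 2) * χ'' x with hΨxx
  set Ψt : ℝ → ℝ → ℝ := fun x t => -(64 * d * a ^ 2 * x ^ 2) * Real.exp (-α t * x ^ 2) * χ x with hΨt
  have dexp : ∀ x t, HasDerivAt (fun y => Real.exp (-α t * y ^ 2))
      (-2 * α t * x * Real.exp (-α t * x ^ 2)) x := fun x t => by
    have := ((hasDerivAt_pow 2 x).const_mul (-α t)).exp
    exact this.congr_deriv (by push_cast; ring)
  have dΨ : ∀ x t, HasDerivAt (fun y => Ψ y t) (Ψx x t) x := fun x t =>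
    (dexp x t).mul (c1 x)
  have dΨx : ∀ x t, HasDerivAt (fun y => Ψx y t) (Ψxx x t) x := fun x t => by
    have h := (((hasDerivAt_id x).const_mul (-2 * α t)).mul (dexp x t)).mul (c1 x)
    exact (h.add ((dexp x t).mul (c2 x))).congr_deriv (by simp only [hΨxx, id, Pi.mul_apply]; ring)
  have dΨt : ∀ x t, HasDerivAt (fun s => Ψ x s) (Ψt x t) t := fun x t => by
    have h1 : HasDerivAt α (64 * d * a ^ 2) t :=
      ((((hasDerivAt_id t).sub_const t₀).const_mul _).const_add _).congr_deriv (mul_one _)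
    exact (((h1.neg.mul_const (x ^ 2)).exp).mul_const (χ x)).congr_deriv
      (by simp only [hΨt, Pi.neg_apply]; ring)
  have cΨ : Continuous fun z : ℝ × ℝ => Ψ z.1 z.2 := by fun_prop
  have cΨt : Continuous fun z : ℝ × ℝ => Ψt z.1 z.2 := by fun_prop
  have hΨ0 : ∀ x t, 0 ≤ Ψ x t := fun x t => mul_nonneg (Real.exp_nonneg _) (c4 x)
  have zΨ : ∀ x t, 2 * R < |x| → Ψ x t = 0 := fun x t hx => by simp [hΨ, c5 x hx]
  have zΨx : ∀ x t, 2 * R < |x| → Ψx x t = 0 := fun x t hx => by simp [hΨx, c5 x hx, c6 x hx]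
  have zΨxx : ∀ x t, 2 * R < |x| → Ψxx x t = 0 := fun x t hx => by
    simp [hΨxx, c5 x hx, c6 x hx, c7 x hx]
  have zΨt : ∀ x t, 2 * R < |x| → Ψt x t = 0 := fun x t hx => by simp [hΨt, c5 x hx]
  have cE : ContinuousOn (fun t => ∫ x, softPos (w x t) * Ψ x t) (Icc t₀ t₁) :=
    continuousOn_integral_of_bounded_support (L := 2 * R) (cW.mul cΨ.continuousOn)
      fun x hx t _ => by simp [zΨ x t hx]
  have dE : ∀ t ∈ Ioo t₀ t₁, HasDerivAt (fun t => ∫ x, softPos (w x t) * Ψ x t)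
      (∫ x, (softPosDeriv (w x t) * timeDeriv w x t * Ψ x t + softPos (w x t) * Ψt x t)) t :=
    fun t ht => hasDerivAt_integral_of_bounded_support (L := 2 * R) (g := fun x t =>
      softPos (w x t) * Ψ x t) (g' := fun x t => softPosDeriv (w x t) * timeDeriv w x t * Ψ x t
        + softPos (w x t) * Ψt x t) (cW'.mul cΨ.continuousOn)
      (((cD.mul cwt).mul cΨ.continuousOn).add (cW'.mul cΨt.continuousOn))
      (fun x t ht => ((hasDerivAt_softPos (w x t)).comp t
        (hcl.diff_time x t (hIoo ht)).hasDerivAt).mul (dΨt x t))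
      (fun x hx t _ => by simp [zΨ x t hx]) (fun x hx t _ => by simp [zΨ x t hx, zΨt x t hx]) ht
  have hE' : ∀ t ∈ Ioo t₀ t₁,
      ∫ x, (softPosDeriv (w x t) * timeDeriv w x t * Ψ x t + softPos (w x t) * Ψt x t)
        ≤ D * ∫ x, G x t := fun t ht => by
    have htT := hIoo ht
    have sW := continuous_slice (g := fun x t => softPos (w x t)) cW' ht
    have sD := continuous_slice (g := fun x t => softPosDeriv (w x t)) cD ht
    have st := continuous_slice (g := timeDeriv w) cwt ht
    have sxx := continuous_slice (g := spaceDeriv (spaceDeriv w)) hcl.cont_space_two htT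
    have sΨ : Continuous fun x => Ψ x t := cΨ.comp (by fun_prop : Continuous fun x : ℝ => (x, t))
    have sΨt : Continuous fun x => Ψt x t :=
      cΨt.comp (by fun_prop : Continuous fun x : ℝ => (x, t))
    have sΨxx : Continuous fun x => Ψxx x t := by fun_prop
    have iWt : Integrable fun x => softPos (w x t) * Ψt x t :=
      integrable_of_abs_support (L := 2 * R) (sW.mul sΨt) fun x hx => by simp [zΨt x t hx]
    have iWxx : Integrable fun x => softPos (w x t) * Ψxx x t :=
      integrable_of_abs_support (L := 2 * R) (sW.mul sΨxx) fun x hx => by simp [zΨxx x t hx]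
    have i1 : Integrable fun x => softPosDeriv (w x t) * timeDeriv w x t * Ψ x t :=
      integrable_of_abs_support (L := 2 * R) ((sD.mul st).mul sΨ) fun x hx => by simp [zΨ x t hx]
    have i2 : Integrable fun x => softPosDeriv (w x t) * spaceDeriv (spaceDeriv w) x t * Ψ x t :=
      integrable_of_abs_support (L := 2 * R) ((sD.mul sxx).mul sΨ) fun x hx => by simp [zΨ x t hx]
    have iG : Integrable fun x => G x t :=
      integrable_of_abs_support (L := 4 * R)
        (continuous_slice (g := G) cG (Ioo_subset_Icc_self ht)) fun x hx => by simp [hG, x5 x hx]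
    have s1 : ∫ x, softPosDeriv (w x t) * timeDeriv w x t * Ψ x t
        ≤ d * ∫ x, softPosDeriv (w x t) * spaceDeriv (spaceDeriv w) x t * Ψ x t := by
      rw [← integral_const_mul]
      refine integral_mono i1 (i2.const_mul d) fun x => ?_
      have h1 := softPosDeriv_nonneg (w x t)
      have h2 := hΨ0 x t
      calc softPosDeriv (w x t) * timeDeriv w x t * Ψ x t
          ≤ softPosDeriv (w x t) * (d * spaceDeriv (spaceDeriv w) x t) * Ψ x t := by
            gcongr; exact hsub x t htT
        _ = _ := by ring
    have s2 : ∫ x, softPosDeriv (w x t) * spaceDeriv (spaceDeriv w) x t * Ψ x t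
        ≤ ∫ x, softPos (w x t) * Ψxx x t :=
      integral_softPosDeriv_mul_le (v' := fun x => spaceDeriv w x t)
        (φ' := fun x => Ψx x t) (L := 2 * R)
        (fun x => (hcl.diff_space x t htT).hasDerivAt)
        (fun x => (hcl.diff_space_two x t htT).hasDerivAt) sxx (fun x => dΨ x t) (fun x => dΨx x t)
        sΨxx (fun x => zΨ x t) (fun x => zΨx x t) (fun x => zΨxx x t) (fun x => hΨ0 x t)
    rw [integral_add i1 iWt]
    calc _ ≤ d * (∫ x, softPos (w x t) * Ψxx x t) + ∫ x, softPos (w x t) * Ψt x t := by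
          have := mul_le_mul_of_nonneg_left s2 hd.le
          linarith
      _ = ∫ x, (d * (softPos (w x t) * Ψxx x t) + softPos (w x t) * Ψt x t) := by
          rw [integral_add (iWxx.const_mul d) iWt, integral_const_mul]
      _ ≤ ∫ x, D * G x t := by
          refine integral_mono ((iWxx.const_mul d).add iWt) (iG.const_mul D) fun x => ?_
          have hW := softPos_nonneg (w x t)
          have key : d * Ψxx x t + Ψt x t ≤ D * (Real.exp (-a * x ^ 2) * ξ x) := by
            rcases le_or_gt |x| (2 * R) with hx | hx
            · rw [x4 x hx, mul_one]
              have h1 : t - t₀ ≤ t₁ - t₀ := by linarith [ht.2]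
              have h2 : 0 ≤ t - t₀ := by linarith [ht.1]
              refine gaussian_test_bound hd ha hC hR ?_ ?_ (c4 x) (c8 x) (c9 x)
              · have : 0 ≤ 64 * d * a ^ 2 * (t - t₀) := by positivity
                simp only [hα]; linarith
              -- The length of the time step is exactly what keeps `α ≤ 4a`: the increment `64 d a²
              -- (t - t₀)` is at most `2a`.
              · have : 32 * d * a * (t - t₀) ≤ 1 := by
                  refine le_trans ?_ hlen
                  gcongr
                simp only [hα]; nlinarith
            · rw [zΨxx x t hx, zΨt x t hx]
              have := x2 x
              have : 0 ≤ D * (Real.exp (-a * x ^ 2) * ξ x) := by positivity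
              simpa using this
          calc d * (softPos (w x t) * Ψxx x t) + softPos (w x t) * Ψt x t
              = softPos (w x t) * (d * Ψxx x t + Ψt x t) := by ring
            _ ≤ softPos (w x t) * (D * (Real.exp (-a * x ^ 2) * ξ x)) := by gcongr
            _ = D * G x t := by simp only [hG]; ring
      _ = D * ∫ x, G x t := integral_const_mul _ _
  -- The energy vanishes at `t₀`, where `w ≤ 0`, so integrating the differential inequality bounds
  -- it at `t₁`.
  have fin := intervalIntegral.sub_le_integral_of_hasDeriv_right_of_le h01 cE
    (fun t ht => (dE t ht).hasDerivWithinAt) (cGi.const_smul D).integrableOn_Icc hE'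
  have hz : ∫ x, softPos (w x t₀) * Ψ x t₀ = 0 := by simp [softPos_of_nonpos (hinit _)]
  simp only [hz, sub_zero, Pi.smul_apply, smul_eq_mul] at fin
  refine fin.trans ?_
  rw [intervalIntegral.integral_const_mul]
  gcongr

/-- If `w` were positive at a point at time `t₁`, the energy seen through one fixed cutoff would be
a positive constant, yet it lies below the energies for large `R`, which are `O(1/R)`. -/
lemma IsClassical.subsolution_nonpos_step {d a T t₀ t₁ : ℝ} {w : ℝ → ℝ → ℝ} (hd : 0 < d)
    (ha : 0 < a) (hcl : IsClassical T w)
    (hsub : ∀ x, ∀ t ∈ Ioo 0 T, timeDeriv w x t ≤ d * spaceDeriv (spaceDeriv w) x t)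
    (hK : ∫⁻ t in Ioo 0 T, ∫⁻ x, ENNReal.ofReal (max (w x t) 0 * Real.exp (-a * x ^ 2)) < ⊤)
    (ht₀ : 0 ≤ t₀) (h01 : t₀ ≤ t₁) (ht₁ : t₁ < T) (hlen : 32 * d * a * (t₁ - t₀) ≤ 1)
    (hinit : ∀ x, w x t₀ ≤ 0) (x : ℝ) : w x t₁ ≤ 0 := by
  by_contra! hx
  obtain ⟨C, χ, χ', χ'', hC, hχ⟩ := exists_cutoff
  set K := (∫⁻ t in Ioo 0 T, ∫⁻ x,
    ENNReal.ofReal (max (w x t) 0 * Real.exp (-a * x ^ 2))).toReal with hKdef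
  have hK' := (ENNReal.ofReal_toReal hK.ne).ge
  have est : ∀ R, 1 ≤ R → ∫ x, softPos (w x t₁) *
      (Real.exp (-(2 * a + 64 * d * a ^ 2 * (t₁ - t₀)) * x ^ 2) * χ R x)
      ≤ d * C * (16 * a + 17) / R * K := fun R hR => by
    obtain ⟨c1, c2, c3, c4, -, -, c5, c6, c7, c8, c9⟩ := hχ R hR
    obtain ⟨e1, -, -, e4, e5, e6, e7, -⟩ := hχ (2 * R) (by linarith)
    refine hcl.softPos_energy_le hd ha hsub hK' ENNReal.toReal_nonneg ht₀ h01 ht₁ hlen hinit hC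
      (by linarith) c1 c2 c3 c4 c5 c6 c7 c8 c9 (ξ := χ (2 * R))
      (continuous_iff_continuousAt.2 fun x => (e1 x).continuousAt) e4 e5 e6 fun x hx => e7 x ?_
    linarith
  have ht₁' : t₁ ∈ Icc 0 T := ⟨ht₀.trans h01, ht₁.le⟩
  have hN : 1 ≤ |x| + 1 := by linarith [abs_nonneg x]
  obtain ⟨n1, -, -, n4, n5, n6, n7, -⟩ := hχ (|x| + 1) hN
  set e : ℝ → ℝ := fun x => Real.exp (-(2 * a + 64 * d * a ^ 2 * (t₁ - t₀)) * x ^ 2) with he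
  have ce : Continuous e := by fun_prop
  have he0 : ∀ x, 0 < e x := fun x => Real.exp_pos _
  have cW : Continuous fun x => softPos (w x t₁) :=
    continuous_softPos.comp (continuous_slice (g := w) hcl.cont ht₁')
  have cN : Continuous (χ (|x| + 1)) :=
    continuous_iff_continuousAt.2 fun x => (n1 x).continuousAt
  have cI : Continuous fun x_1 => softPos (w x_1 t₁) * (e x_1 * χ (|x| + 1) x_1) :=
    cW.mul (ce.mul cN)
  have zI : ∀ y, 2 * (|x| + 1) < |y| → softPos (w y t₁) * (e y * χ (|x| + 1) y) = 0 :=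
    fun y hy => by simp [n7 y hy]
  have hpos : 0 < ∫ y, softPos (w y t₁) * (e y * χ (|x| + 1) y) := by
    refine cI.integral_pos_of_hasCompactSupport_nonneg_nonzero (x := x)
      (hasCompactSupport_of_abs zI) (fun y => ?_) ?_
    · exact mul_nonneg (softPos_nonneg _) (mul_nonneg (he0 y).le (n4 y))
    · rw [n6 x (by linarith)]
      have := softPos_pos hx
      have := he0 x
      positivity
  -- Monotonicity of `χ R` in `R` is not available; for `R ≥ 2 (|x| + 1)` the cutoff `χ R` is `1` on
  -- the support of the fixed one and therefore dominates it.
  have hle : ∀ R, 2 * (|x| + 1) ≤ R → ∫ y, softPos (w y t₁) * (e y * χ (|x| + 1) y)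
      ≤ d * C * (16 * a + 17) / R * K := fun R hR => by
    have hR1 : 1 ≤ R := by linarith
    refine le_trans ?_ (est R hR1)
    obtain ⟨c1, -, -, c4, -, c6, c5, -⟩ := hχ R hR1
    have cR : Continuous (χ R) := continuous_iff_continuousAt.2 fun x => (c1 x).continuousAt
    refine integral_mono (integrable_of_abs_support cI zI)
      (integrable_of_abs_support (L := 2 * R) (cW.mul (ce.mul cR)) fun y hy => by simp [c5 y hy])
      fun y => ?_
    refine mul_le_mul_of_nonneg_left (mul_le_mul_of_nonneg_left ?_ (he0 y).le) (softPos_nonneg _)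
    rcases le_or_gt |y| (2 * (|x| + 1)) with hy | hy
    · rw [c6 y (hy.trans hR)]; exact n5 y
    · rw [n7 y hy]; exact c4 y
  have lim : Tendsto (fun R : ℝ => d * C * (16 * a + 17) / R * K) atTop (𝓝 (0 * K)) :=
    (tendsto_const_nhds.div_atTop tendsto_id).mul_const K
  rw [zero_mul] at lim
  exact absurd (ge_of_tendsto lim ((eventually_ge_atTop _).mono hle)) (not_le.2 hpos)

/-- Comparison principle: a subsolution of the heat equation that is nonpositive at time `0` and
whose positive part has Gaussian growth is nonpositive. -/
theorem IsClassical.subsolution_nonpos {d a T : ℝ} {w : ℝ → ℝ → ℝ} (hd : 0 < d)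
    (ha : 0 < a) (hcl : IsClassical T w)
    (hsub : ∀ x, ∀ t ∈ Ioo 0 T, timeDeriv w x t ≤ d * spaceDeriv (spaceDeriv w) x t)
    (hK : ∫⁻ t in Ioo 0 T, ∫⁻ x, ENNReal.ofReal (max (w x t) 0 * Real.exp (-a * x ^ 2)) < ⊤)
    (hinit : ∀ x, w x 0 ≤ 0) {t : ℝ} (ht : t ∈ Icc 0 T) (x : ℝ) : w x t ≤ 0 := by
  have hε : 0 < 32 * d * a := by positivity
  -- `n` counts time steps of length `1 / (32 d a)`; each restarts the energy estimate from a time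
  -- at which `w ≤ 0` is already known.
  have step : ∀ n : ℕ, ∀ t, 0 ≤ t → t < T → 32 * d * a * t ≤ n → ∀ x, w x t ≤ 0 := by
    intro n
    induction n with
    | zero =>
      intro t h0 _ h
      have : t = 0 := by
        by_contra hne
        have : 0 < t := lt_of_le_of_ne h0 (Ne.symm hne)
        have : 0 < 32 * d * a * t := by positivity
        simp only [Nat.cast_zero] at h
        linarith
      exact this ▸ hinit
    | succ n ih =>
      intro t h0 hT h x
      push_cast at h
      have h1 : 32 * d * a * (t - 1 / (32 * d * a)) = 32 * d * a * t - 1 := by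
        field_simp
      have h2 : 0 < 1 / (32 * d * a) := by positivity
      refine hcl.subsolution_nonpos_step hd ha hsub hK (t₀ := max 0 (t - 1 / (32 * d * a)))
        (le_max_left _ _) (max_le h0 (by linarith)) hT ?_ (ih _ (le_max_left _ _) ?_ ?_) x
      · calc 32 * d * a * (t - max 0 (t - 1 / (32 * d * a)))
            ≤ 32 * d * a * (t - (t - 1 / (32 * d * a))) := by gcongr; exact le_max_right _ _
          _ = 1 := by field_simp; ring
      · exact max_lt (h0.trans_lt hT) (by linarith)
      · rcases max_choice 0 (t - 1 / (32 * d * a)) with h3 | h3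
        · rw [h3, mul_zero]; positivity
        · rw [h3, h1]; linarith
  have hlt : ∀ t, 0 ≤ t → t < T → ∀ x, w x t ≤ 0 := fun t h0 hT => by
    obtain ⟨n, hn⟩ := exists_nat_ge (32 * d * a * t)
    exact step n t h0 hT hn
  -- The energy estimate stops short of `T`; the final time follows by continuity, or from the
  -- initial condition if `T = 0`.
  rcases ht.2.lt_or_eq with hT | rfl
  · exact hlt t ht.1 hT x
  rcases ht.1.lt_or_eq with h0 | h0
  · have hc : ContinuousWithinAt (fun s => w x s) (Ico 0 t) t := by
      have := hcl.cont (x, t) ⟨mem_univ _, ht⟩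
      exact ContinuousWithinAt.comp (t := univ ×ˢ Icc 0 t) (f := fun s : ℝ => (x, s)) this
        (by fun_prop) fun s hs => ⟨mem_univ _, hs.1, hs.2.le⟩
    have : (𝓝[Ico 0 t] t).NeBot := by
      rw [← mem_closure_iff_nhdsWithin_neBot, closure_Ico h0.ne]
      exact ht
    exact le_of_tendsto hc (eventually_mem_nhdsWithin.mono fun s hs => hlt s hs.1 hs.2 x)
  · rw [← h0]; exact hinit x

/-! ### Finite cost and integrability of the initial datum -/

lemma hasDerivAt_inv_sqrt_one_add_sq (x : ℝ) :
    HasDerivAt (fun y : ℝ => (√(1 + y ^ 2))⁻¹) (-x / √(1 + x ^ 2) ^ 3) x := by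
  have h0 : (1 + x ^ 2 : ℝ) ≠ 0 := by positivity
  have hr : √(1 + x ^ 2) ≠ 0 := by positivity
  have h1 : HasDerivAt (fun y : ℝ => 1 + y ^ 2) (2 * x) x := by
    simpa using (hasDerivAt_pow 2 x).const_add 1
  refine ((h1.sqrt h0).inv hr).congr_deriv ?_
  field_simp

lemma hasDerivAt_deriv_inv_sqrt_one_add_sq (x : ℝ) :
    HasDerivAt (fun y : ℝ => -y / √(1 + y ^ 2) ^ 3)
      (-1 / √(1 + x ^ 2) ^ 3 + 3 * x ^ 2 / √(1 + x ^ 2) ^ 5) x := by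
  have h0 : (1 + x ^ 2 : ℝ) ≠ 0 := by positivity
  have hr : √(1 + x ^ 2) ≠ 0 := by positivity
  have h1 : HasDerivAt (fun y : ℝ => 1 + y ^ 2) (2 * x) x := by
    simpa using (hasDerivAt_pow 2 x).const_add 1
  refine ((hasDerivAt_id x).neg.div ((h1.sqrt h0).pow 3) (pow_ne_zero 3 hr)).congr_deriv ?_
  simp only [id, Pi.neg_apply, Pi.pow_apply]
  field_simp
  ring

/-- The left side is `|(ψ χ)''|` for `ψ = 1 / r`, `r = √(1 + x²)`. Since `ψ' = O(r⁻²)` and `ψ'' =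
O(r⁻³)` with `r ≥ 1`, everything is a multiple of `ψ`, so the diffusion term costs no more than a
zeroth-order one. -/
lemma inv_sqrt_test_bound {C χ χ' χ'' : ℝ} (x : ℝ) (h0 : 0 ≤ χ) (h0' : χ ≤ 1) (h1 : |χ'| ≤ C)
    (h2 : |χ''| ≤ C) :
    |(-1 / √(1 + x ^ 2) ^ 3 + 3 * x ^ 2 / √(1 + x ^ 2) ^ 5) * χ
      + 2 * (-x / √(1 + x ^ 2) ^ 3) * χ' + (√(1 + x ^ 2))⁻¹ * χ''|
      ≤ (4 + 3 * C) * (√(1 + x ^ 2))⁻¹ := by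
  set r := √(1 + x ^ 2) with hr
  have hr2 : r ^ 2 = 1 + x ^ 2 := Real.sq_sqrt (by positivity)
  have hr1 : 1 ≤ r := Real.one_le_sqrt.2 (by nlinarith [sq_nonneg x])
  have hxr : |x| ≤ r := Real.abs_le_sqrt (by linarith)
  have hr0 : 0 < r := by linarith
  have b1 : |-1 / r ^ 3 + 3 * x ^ 2 / r ^ 5| ≤ 4 * r⁻¹ := by
    have e1 : 1 / r ^ 3 ≤ r⁻¹ := by
      rw [inv_eq_one_div]
      exact one_div_le_one_div_of_le hr0 (le_self_pow₀ hr1 (by norm_num))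
    have e2 : 3 * x ^ 2 / r ^ 5 ≤ 3 * (1 / r ^ 3) := by
      have : x ^ 2 ≤ r ^ 2 := by linarith
      calc 3 * x ^ 2 / r ^ 5 ≤ 3 * r ^ 2 / r ^ 5 := by gcongr
        _ = _ := by field_simp
    have e3 : 0 ≤ 3 * x ^ 2 / r ^ 5 := by positivity
    have e4 : 0 ≤ 1 / r ^ 3 := by positivity
    rw [neg_div, abs_le]
    constructor <;> linarith
  have b2 : |-x / r ^ 3| ≤ r⁻¹ := by
    rw [abs_div, abs_neg, abs_of_pos (pow_pos hr0 3)]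
    calc |x| / r ^ 3 ≤ r / r ^ 3 := by gcongr
      _ = 1 / r ^ 2 := by field_simp
      _ ≤ r⁻¹ := by
        rw [inv_eq_one_div]
        exact one_div_le_one_div_of_le hr0 (le_self_pow₀ hr1 (by norm_num))
  have hri : 0 ≤ r⁻¹ := by positivity
  calc _ ≤ |(-1 / r ^ 3 + 3 * x ^ 2 / r ^ 5) * χ| + |2 * (-x / r ^ 3) * χ'| + |r⁻¹ * χ''| :=
        abs_add_three _ _ _
    _ = |-1 / r ^ 3 + 3 * x ^ 2 / r ^ 5| * χ + 2 * |-x / r ^ 3| * |χ'| + r⁻¹ * |χ''| := by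
        rw [abs_mul, abs_mul, abs_mul, abs_mul, abs_of_nonneg h0, abs_two, abs_of_nonneg hri]
    _ ≤ 4 * r⁻¹ * 1 + 2 * r⁻¹ * C + r⁻¹ * C := by gcongr
    _ = _ := by ring

/-- Under the state equation, an `L²` bound on state and control controls the initial datum. -/
lemma IsAdmissible.integral_cutoff_le {d η δ ρ T K : ℝ} {p0 : ℝ → ℝ} {p u : ℝ → ℝ → ℝ}
    (hd : 0 < d) (hη : 0 < η) (hρ : 0 < ρ) (hT : 0 < T) (h : IsAdmissible d η δ T p0 p u)
    (hK : ∫⁻ t in Ioo 0 T, ∫⁻ x,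
      ENNReal.ofReal ((p x t ^ 2 + u x t ^ 2) / 2 * Real.exp (-ρ * t)) ≤ ENNReal.ofReal K)
    (hK0 : 0 ≤ K) {C : ℝ} {R : ℝ}
    {χ χ' χ'' ξ : ℝ → ℝ} (c1 : ∀ x, HasDerivAt χ (χ' x) x) (c2 : ∀ x, HasDerivAt χ' (χ'' x) x)
    (c3 : Continuous χ'') (c4 : ∀ x, 0 ≤ χ x) (c4' : ∀ x, χ x ≤ 1)
    (c5 : ∀ x, 2 * R < |x| → χ x = 0) (c6 : ∀ x, 2 * R < |x| → χ' x = 0)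
    (c7 : ∀ x, 2 * R < |x| → χ'' x = 0) (c8 : ∀ x, |χ' x| ≤ C) (c9 : ∀ x, |χ'' x| ≤ C)
    (x1 : Continuous ξ) (x2 : ∀ x, 0 ≤ ξ x) (x3 : ∀ x, ξ x ≤ 1) (x4 : ∀ x, |x| ≤ 2 * R → ξ x = 1)
    (x5 : ∀ x, 4 * R < |x| → ξ x = 0) :
    T / 2 * ∫ x, p0 x * ((√(1 + x ^ 2))⁻¹ * χ x)
      ≤ (1 + T * (d * (4 + 3 * C) + |η - δ| + η))
        * (Real.exp (ρ * T) * K + T * ∫ x : ℝ, (1 + x ^ 2)⁻¹) := by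
  have hcl := h.classical
  have hC : 0 ≤ C := (abs_nonneg _).trans (c8 0)
  set ψ : ℝ → ℝ := fun x => (√(1 + x ^ 2))⁻¹ with hψ
  have hψ0 : ∀ x, 0 ≤ ψ x := fun x => by positivity
  have cψ : Continuous ψ := continuous_iff_continuousAt.2 fun x =>
    (hasDerivAt_inv_sqrt_one_add_sq x).continuousAt
  have hψ2 : ∀ x, ψ x ^ 2 = (1 + x ^ 2)⁻¹ := fun x => by
    rw [hψ, inv_pow, Real.sq_sqrt (by positivity)]
  have cχ : Continuous χ := continuous_iff_continuousAt.2 fun x => (c1 x).continuousAt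
  have cχ' : Continuous χ' := continuous_iff_continuousAt.2 fun x => (c2 x).continuousAt
  have hsqrt : ∀ (n : ℕ) (x : ℝ), √(1 + x ^ 2) ^ n ≠ 0 := fun n x => by positivity
  set Ψ : ℝ → ℝ := fun x => ψ x * χ x with hΨ
  set Ψ' : ℝ → ℝ := fun x => -x / √(1 + x ^ 2) ^ 3 * χ x + ψ x * χ' x with hΨ'
  set Ψ'' : ℝ → ℝ := fun x => (-1 / √(1 + x ^ 2) ^ 3 + 3 * x ^ 2 / √(1 + x ^ 2) ^ 5) * χ x
      + 2 * (-x / √(1 + x ^ 2) ^ 3) * χ' x + ψ x * χ'' x with hΨ''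
  have dΨ : ∀ x, HasDerivAt Ψ (Ψ' x) x := fun x =>
    (hasDerivAt_inv_sqrt_one_add_sq x).mul (c1 x)
  have dΨ' : ∀ x, HasDerivAt Ψ' (Ψ'' x) x := fun x =>
    (((hasDerivAt_deriv_inv_sqrt_one_add_sq x).mul (c1 x)).add
      ((hasDerivAt_inv_sqrt_one_add_sq x).mul (c2 x))).congr_deriv (by simp only [hΨ'']; ring)
  have cΨ : Continuous Ψ := cψ.mul cχ
  have cΨ'' : Continuous Ψ'' := by
    refine ((Continuous.mul (Continuous.add ?_ ?_) cχ).add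
      ((continuous_const.mul ?_).mul cχ')).add (cψ.mul c3)
    · exact Continuous.div (by fun_prop) (by fun_prop) (hsqrt 3)
    · exact Continuous.div (by fun_prop) (by fun_prop) (hsqrt 5)
    · exact Continuous.div (by fun_prop) (by fun_prop) (hsqrt 3)
  have zΨ : ∀ x, 2 * R < |x| → Ψ x = 0 := fun x hx => by simp [hΨ, c5 x hx]
  have zΨ' : ∀ x, 2 * R < |x| → Ψ' x = 0 := fun x hx => by simp [hΨ', c5 x hx, c6 x hx]
  have zΨ'' : ∀ x, 2 * R < |x| → Ψ'' x = 0 := fun x hx => by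
    simp [hΨ'', c5 x hx, c6 x hx, c7 x hx]
  have bΨ : ∀ x, |Ψ x| ≤ ψ x * ξ x := fun x => by
    rcases le_or_gt |x| (2 * R) with hx | hx
    · rw [x4 x hx, abs_mul, abs_of_nonneg (hψ0 x), abs_of_nonneg (c4 x)]
      exact mul_le_mul_of_nonneg_left (c4' x) (hψ0 x)
    · rw [zΨ x hx, abs_zero]; exact mul_nonneg (hψ0 x) (x2 x)
  have bΨ'' : ∀ x, |Ψ'' x| ≤ (4 + 3 * C) * (ψ x * ξ x) := fun x => by
    rcases le_or_gt |x| (2 * R) with hx | hx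
    · rw [x4 x hx, mul_one]
      exact inv_sqrt_test_bound x (c4 x) (c4' x) (c8 x) (c9 x)
    · rw [zΨ'' x hx, abs_zero]; exact mul_nonneg (by positivity) (mul_nonneg (hψ0 x) (x2 x))
  have cp : ContinuousOn (fun z : ℝ × ℝ => p z.1 z.2) (univ ×ˢ Ioo 0 T) :=
    hcl.cont.mono (prod_mono_right Ioo_subset_Icc_self)
  -- No regularity of the control is assumed; its continuity is read off the state equation solved
  -- for `u`.
  have cu : ContinuousOn (fun z : ℝ × ℝ => u z.1 z.2) (univ ×ˢ Ioo 0 T) := by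
    refine ContinuousOn.congr (f := fun z : ℝ × ℝ => (d * spaceDeriv (spaceDeriv p) z.1 z.2
      + (η - δ) * p z.1 z.2 - timeDeriv p z.1 z.2) / η) ?_ fun z hz => ?_
    · exact (((hcl.cont_space_two.const_smul d).add (cp.const_smul (η - δ))).sub
        hcl.cont_time).div_const η
    · simp only [h.state_eq z.1 z.2 hz.2]
      field_simp
      ring
  set G : ℝ → ℝ → ℝ := fun x t => (p x t ^ 2 + u x t ^ 2) / 2 * Real.exp (-ρ * t) * ξ x with hG
  have hG0 : ∀ x t, 0 ≤ G x t := fun x t => mul_nonneg (by positivity) (x2 x)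
  have cG : ContinuousOn (fun z : ℝ × ℝ => G z.1 z.2) (univ ×ˢ Ioo 0 T) :=
    ((((cp.pow 2).add (cu.pow 2)).div_const 2).mul
      (Continuous.continuousOn (by fun_prop))).mul (Continuous.continuousOn (by fun_prop))
  have cGi : ContinuousOn (fun t => ∫ x, G x t) (Ioo 0 T) :=
    continuousOn_integral_of_bounded_support (L := 4 * R) cG fun x hx t _ => by simp [hG, x5 x hx]
  have hGle : ∀ s t, 0 ≤ s → s ≤ t → t < T → ∫ τ in s..t, ∫ x, G x τ ≤ K := fun s t hs hst ht => by
    have := (ofReal_intervalIntegral_integral_le hs hst ht fun x τ _ => hG0 x τ).trans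
      ((lintegral_mono fun τ => lintegral_mono fun x => ENNReal.ofReal_le_ofReal
        (mul_le_of_le_one_right (by positivity) (x3 x))).trans hK)
    exact (ENNReal.ofReal_le_ofReal_iff hK0).1 this
  set P := ∫ x : ℝ, (1 + x ^ 2)⁻¹ with hP
  have iP : Integrable fun x : ℝ => (1 + x ^ 2)⁻¹ := integrable_inv_one_add_sq
  have hP0 : 0 ≤ P := integral_nonneg fun x => by positivity
  set A := 1 + T * (d * (4 + 3 * C) + |η - δ| + η) with hA
  have hA0 : 0 ≤ A := by positivity
  set E : ℝ → ℝ := fun t => ∫ x, p x t * Ψ x with hE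
  have cE : ContinuousOn E (Icc 0 T) :=
    continuousOn_integral_of_bounded_support (L := 2 * R) (g := fun x t => p x t * Ψ x)
      (hcl.cont.mul (Continuous.continuousOn (by fun_prop))) fun x hx t _ => by simp [zΨ x hx]
  have dE : ∀ t ∈ Ioo 0 T, HasDerivAt E (∫ x, timeDeriv p x t * Ψ x) t := fun t ht =>
    hasDerivAt_integral_of_bounded_support (L := 2 * R) (g := fun x t => p x t * Ψ x)
      (g' := fun x t => timeDeriv p x t * Ψ x)
      (cp.mul (Continuous.continuousOn (by fun_prop)))
      (hcl.cont_time.mul (Continuous.continuousOn (by fun_prop)))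
      (fun x t ht => (hcl.diff_time x t ht).hasDerivAt.mul_const _)
      (fun x hx t _ => by simp [zΨ x hx]) (fun x hx t _ => by simp [zΨ x hx]) ht
  -- This is the derivative of `(t - T / 2) * E t`. The factor vanishes at `T / 2`, so integration
  -- leaves only the initial value and no later boundary term.
  have bound : ∀ t ∈ Ioo 0 (T / 2), 1 * E t + (t - T / 2) * (∫ x, timeDeriv p x t * Ψ x)
      ≤ A * (Real.exp (ρ * T) * (∫ x, G x t) + P) := fun t ht => by
    have htT : t ∈ Ioo 0 T := ⟨ht.1, by linarith [ht.2]⟩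
    have sp := continuous_slice (g := p) cp htT
    have su := continuous_slice (g := u) cu htT
    have sxx := continuous_slice (g := spaceDeriv (spaceDeriv p)) hcl.cont_space_two htT
    have ip : Integrable fun x => p x t * Ψ x :=
      integrable_of_abs_support (L := 2 * R) (sp.mul cΨ) fun x hx => by simp [zΨ x hx]
    have ip2 : Integrable fun x => p x t * Ψ'' x :=
      integrable_of_abs_support (L := 2 * R) (sp.mul cΨ'') fun x hx => by simp [zΨ'' x hx]
    have iu : Integrable fun x => u x t * Ψ x :=
      integrable_of_abs_support (L := 2 * R) (su.mul cΨ) fun x hx => by simp [zΨ x hx]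
    have ixx : Integrable fun x => spaceDeriv (spaceDeriv p) x t * Ψ x :=
      integrable_of_abs_support (L := 2 * R) (sxx.mul cΨ) fun x hx => by simp [zΨ x hx]
    have iG : Integrable fun x => G x t :=
      integrable_of_abs_support (L := 4 * R)
        (continuous_slice (g := G) cG htT) fun x hx => by simp [hG, x5 x hx]
    have e1 : ∫ x, timeDeriv p x t * Ψ x = d * (∫ x, p x t * Ψ'' x)
        + (η - δ) * (∫ x, p x t * Ψ x) - η * ∫ x, u x t * Ψ x := by
      have ibp : ∫ x, spaceDeriv (spaceDeriv p) x t * Ψ x = ∫ x, p x t * Ψ'' x :=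
        integral_deriv_two_mul (v' := fun x => spaceDeriv p x t) (L := 2 * R)
          (fun x => (hcl.diff_space x t htT).hasDerivAt)
          (fun x => (hcl.diff_space_two x t htT).hasDerivAt) sxx dΨ dΨ' cΨ'' zΨ zΨ' zΨ''
      have i3 : Integrable fun x => d * (spaceDeriv (spaceDeriv p) x t * Ψ x)
        + (η - δ) * (p x t * Ψ x) := (ixx.const_mul d).add (ip.const_mul _)
      rw [← ibp, ← integral_const_mul, ← integral_const_mul, ← integral_const_mul,
        ← integral_add (ixx.const_mul d) (ip.const_mul _), ← integral_sub i3 (iu.const_mul _)]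
      refine integral_congr_ae (Eventually.of_forall fun x => ?_)
      simp only [h.state_eq x t htT]
      ring
    have i4 : Integrable fun x => d * (p x t * Ψ'' x) + (η - δ) * (p x t * Ψ x) :=
      (ip2.const_mul d).add (ip.const_mul _)
    have i5 : Integrable fun x => d * (p x t * Ψ'' x) + (η - δ) * (p x t * Ψ x)
      - η * (u x t * Ψ x) := i4.sub (iu.const_mul _)
    have e2 : 1 * E t + (t - T / 2) * (∫ x, timeDeriv p x t * Ψ x)
        = ∫ x, (p x t * Ψ x + (t - T / 2) * (d * (p x t * Ψ'' x) + (η - δ) * (p x t * Ψ x)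
          - η * (u x t * Ψ x))) := by
      rw [integral_add ip (i5.const_mul _), integral_const_mul, integral_sub i4 (iu.const_mul _),
        integral_add (ip2.const_mul d) (ip.const_mul _), integral_const_mul, integral_const_mul,
        integral_const_mul, e1, one_mul]
    rw [e2, ← integral_const_mul, hP, ← integral_add (iG.const_mul _) iP, ← integral_const_mul]
    refine integral_mono (ip.add (i5.const_mul _)) (((iG.const_mul _).add iP).const_mul A) fun x => ?_
    have hw : 0 ≤ ψ x * ξ x := mul_nonneg (hψ0 x) (x2 x)
    have b0 : |p x t * Ψ x| ≤ |p x t| * (ψ x * ξ x) := by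
      rw [abs_mul]; gcongr; exact bΨ x
    have b1 : |p x t * Ψ'' x| ≤ |p x t| * ((4 + 3 * C) * (ψ x * ξ x)) := by
      rw [abs_mul]; gcongr; exact bΨ'' x
    have b2 : |u x t * Ψ x| ≤ |u x t| * (ψ x * ξ x) := by
      rw [abs_mul]; gcongr; exact bΨ x
    have ht2 : |t - T / 2| ≤ T := by
      rw [abs_le]; constructor <;> linarith [ht.1, ht.2]
    have s1 : |d * (p x t * Ψ'' x) + (η - δ) * (p x t * Ψ x) - η * (u x t * Ψ x)|
        ≤ (d * (4 + 3 * C) + |η - δ| + η) * ((|p x t| + |u x t|) * (ψ x * ξ x)) := by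
      calc _ ≤ |d * (p x t * Ψ'' x)| + |(η - δ) * (p x t * Ψ x)| + |η * (u x t * Ψ x)| :=
            (abs_sub _ _).trans (by gcongr; exact abs_add_le _ _)
        _ = d * |p x t * Ψ'' x| + |η - δ| * |p x t * Ψ x| + η * |u x t * Ψ x| := by
            rw [abs_mul d, abs_mul (η - δ), abs_mul η, abs_of_pos hd, abs_of_pos hη]
        _ ≤ d * (|p x t| * ((4 + 3 * C) * (ψ x * ξ x))) + |η - δ| * (|p x t| * (ψ x * ξ x))
            + η * (|u x t| * (ψ x * ξ x)) := by gcongr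
        _ ≤ d * ((|p x t| + |u x t|) * ((4 + 3 * C) * (ψ x * ξ x)))
            + |η - δ| * ((|p x t| + |u x t|) * (ψ x * ξ x))
            + η * ((|p x t| + |u x t|) * (ψ x * ξ x)) := by
            gcongr <;> linarith [abs_nonneg (p x t), abs_nonneg (u x t)]
        _ = _ := by ring
    have s2 : (|p x t| + |u x t|) * (ψ x * ξ x)
        ≤ Real.exp (ρ * T) * G x t + (1 + x ^ 2)⁻¹ := by
      -- Young's inequality with `ψ² = (1 + x²)⁻¹`, which is integrable on the line.
      have q1 : (|p x t| + |u x t|) * ψ x ≤ (p x t ^ 2 + u x t ^ 2) / 2 + (1 + x ^ 2)⁻¹ := by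
        rw [← hψ2, ← sq_abs (p x t), ← sq_abs (u x t)]
        nlinarith [sq_nonneg (|p x t| - ψ x), sq_nonneg (|u x t| - ψ x)]
      have q2 : 1 ≤ Real.exp (ρ * T) * Real.exp (-ρ * t) := by
        rw [← Real.exp_add]
        exact Real.one_le_exp (by nlinarith [htT.2])
      have q3 : (p x t ^ 2 + u x t ^ 2) / 2 * ξ x ≤ Real.exp (ρ * T) * G x t := by
        have : Real.exp (ρ * T) * G x t = (p x t ^ 2 + u x t ^ 2) / 2 * ξ x
          * (Real.exp (ρ * T) * Real.exp (-ρ * t)) := by simp only [hG]; ring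
        rw [this]
        exact le_mul_of_one_le_right (mul_nonneg (by positivity) (x2 x)) q2
      have q4 : (1 + x ^ 2)⁻¹ * ξ x ≤ (1 + x ^ 2)⁻¹ :=
        mul_le_of_le_one_right (by positivity) (x3 x)
      have := mul_le_mul_of_nonneg_right q1 (x2 x)
      linarith
    calc p x t * Ψ x + (t - T / 2) * (d * (p x t * Ψ'' x) + (η - δ) * (p x t * Ψ x)
          - η * (u x t * Ψ x))
        ≤ |p x t * Ψ x| + |t - T / 2| * |d * (p x t * Ψ'' x) + (η - δ) * (p x t * Ψ x)
          - η * (u x t * Ψ x)| := by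
          rw [← abs_mul]; exact add_le_add (le_abs_self _) (le_abs_self _)
      _ ≤ (|p x t| + |u x t|) * (ψ x * ξ x) + T * ((d * (4 + 3 * C) + |η - δ| + η)
          * ((|p x t| + |u x t|) * (ψ x * ξ x))) := by
          gcongr
          exact b0.trans (by gcongr; linarith [abs_nonneg (u x t)])
      _ = A * ((|p x t| + |u x t|) * (ψ x * ξ x)) := by simp only [hA]; ring
      _ ≤ A * (Real.exp (ρ * T) * G x t + (1 + x ^ 2)⁻¹) := by gcongr
  have main : ∀ s ∈ Ioo 0 (T / 2), (T / 2 - s) * E s ≤ A * (Real.exp (ρ * T) * K + T * P) := by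
    intro s hs
    have hsub : Icc s (T / 2) ⊆ Ioo 0 T := fun t ht => ⟨hs.1.trans_le ht.1, by linarith [ht.2]⟩
    have cGs := (cGi.mono hsub)
    have iGs : IntervalIntegrable (fun t => ∫ x, G x t) volume s (T / 2) :=
      (by rwa [uIcc_of_le hs.2.le] : ContinuousOn _ (uIcc s (T / 2))).intervalIntegrable
    have fin := intervalIntegral.sub_le_integral_of_hasDeriv_right_of_le
      (g := fun t => (t - T / 2) * E t) (φ := fun t => A * (Real.exp (ρ * T) * (∫ x, G x t) + P))
      hs.2.le
      ((Continuous.continuousOn (by fun_prop)).mul (cE.mono (hsub.trans Ioo_subset_Icc_self)))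
      (fun t ht => ((((hasDerivAt_id t).sub_const (T / 2)).mul
        (dE t (hsub (Ioo_subset_Icc_self ht)))).hasDerivWithinAt))
      (ContinuousOn.integrableOn_Icc (((cGs.const_smul (Real.exp (ρ * T))).add
        continuousOn_const).const_smul A))
      (fun t ht => bound t ⟨hs.1.trans ht.1, ht.2⟩)
    rw [intervalIntegral.integral_const_mul, intervalIntegral.integral_add (iGs.const_mul _)
      (by simp), intervalIntegral.integral_const_mul, intervalIntegral.integral_const] at fin
    have h1 := hGle s (T / 2) hs.1.le hs.2.le (by linarith)
    have h2 : (T / 2 - s) • P ≤ T * P := by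
      rw [smul_eq_mul]; gcongr; linarith [hs.1]
    calc (T / 2 - s) * E s = (T / 2 - T / 2) * E (T / 2) - (s - T / 2) * E s := by ring
      _ ≤ _ := fin
      _ ≤ _ := by gcongr
  -- The equation holds only for positive times, so the estimate starts at `s > 0` and the initial
  -- time is reached by continuity of `E`.
  have lim : Tendsto (fun s => (T / 2 - s) * E s) (𝓝[Ioo 0 (T / 2)] 0) (𝓝 ((T / 2 - 0) * E 0)) := by
    refine Tendsto.mul ?_ ?_
    · exact (Continuous.tendsto (by fun_prop) 0).mono_left nhdsWithin_le_nhds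
    · exact ((cE 0 ⟨le_rfl, hT.le⟩).mono (fun t ht => ⟨ht.1.le, by linarith [ht.2]⟩ :
        Ioo 0 (T / 2) ⊆ Icc 0 T))
  have : (𝓝[Ioo 0 (T / 2)] (0 : ℝ)).NeBot := by
    rw [← mem_closure_iff_nhdsWithin_neBot, closure_Ioo (by linarith)]
    exact ⟨le_rfl, by linarith⟩
  have fin := le_of_tendsto lim (eventually_mem_nhdsWithin.mono main)
  simpa only [hE, sub_zero, h.initial] using fin

/-- Finite cost forces the initial datum to be integrable against `1 / √(1 + x²)`. -/
theorem IsAdmissible.integrable_initial {d η δ ρ θ T : ℝ} {p0 : ℝ → ℝ} {p u : ℝ → ℝ → ℝ}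
    (hd : 0 < d) (hη : 0 < η) (hρ : 0 < ρ) (hT : 0 < T) (h : IsAdmissible d η δ T p0 p u)
    (hp0 : ∀ x, 0 < p0 x) (hc : Continuous p0) (hfin : socialCost ρ θ T p u ≠ ⊤) :
    Integrable fun x => p0 x * (√(1 + x ^ 2))⁻¹ := by
  obtain ⟨C, χ, χ', χ'', hC, hχ⟩ := exists_cutoff
  set K := (∫⁻ t in Ioo 0 T, ∫⁻ x,
    ENNReal.ofReal ((p x t ^ 2 + u x t ^ 2) / 2 * Real.exp (-ρ * t))).toReal with hKdef
  have hK := (ENNReal.ofReal_toReal (ne_top_of_le_ne_top hfin le_self_add)).ge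
  obtain ⟨B, est⟩ : ∃ B, ∀ R : ℝ, 1 ≤ R →
      T / 2 * ∫ x, p0 x * ((√(1 + x ^ 2))⁻¹ * χ R x) ≤ B := by
    refine ⟨(1 + T * (d * (4 + 3 * C) + |η - δ| + η))
      * (Real.exp (ρ * T) * K + T * ∫ x : ℝ, (1 + x ^ 2)⁻¹), fun R hR => ?_⟩
    obtain ⟨c1, c2, c3, c4, c4', -, c5, c6, c7, c8, c9⟩ := hχ R hR
    obtain ⟨e1, -, -, e4, e5, e6, e7, -⟩ := hχ (2 * R) (by linarith)
    exact h.integral_cutoff_le hd hη hρ hT hK ENNReal.toReal_nonneg c1 c2 c3 c4 c4' c5 c6 c7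
      (fun x => (c8 x).trans (div_le_self hC hR)) (fun x => (c9 x).trans (div_le_self hC hR))
      (ξ := χ (2 * R)) (continuous_iff_continuousAt.2 fun x => (e1 x).continuousAt) e4 e5 e6
      fun x hx => e7 x (by linarith)
  have cψ : Continuous fun x : ℝ => (√(1 + x ^ 2))⁻¹ := continuous_iff_continuousAt.2 fun x =>
    (hasDerivAt_inv_sqrt_one_add_sq x).continuousAt
  have cI := hc.mul cψ
  -- `B` does not depend on `R`, so the integrals over `[-R, R]` stay bounded.
  refine integrable_of_intervalIntegral_norm_bounded (l := (atTop : Filter ℝ)) (2 / T * B)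
    (fun R => cI.integrableOn_Ioc) tendsto_neg_atTop_atBot tendsto_id
    ((eventually_ge_atTop 1).mono fun R hR => ?_)
  obtain ⟨c1, -, -, c4, -, c6, c5, -⟩ := hχ R hR
  have cχ : Continuous (χ R) := continuous_iff_continuousAt.2 fun x => (c1 x).continuousAt
  have h1 : ∫ x in (-R)..R, ‖p0 x * (√(1 + x ^ 2))⁻¹‖
      ≤ ∫ x, p0 x * ((√(1 + x ^ 2))⁻¹ * χ R x) := by
    have h0 : ∀ x, 0 ≤ p0 x * (√(1 + x ^ 2))⁻¹ := fun x =>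
      mul_nonneg (hp0 x).le (by positivity)
    rw [intervalIntegral.integral_of_le (by linarith)]
    calc _ = ∫ x in Ioc (-R) R, p0 x * ((√(1 + x ^ 2))⁻¹ * χ R x) := by
          refine setIntegral_congr_fun measurableSet_Ioc fun x hx => ?_
          simp only [c6 x (abs_le.2 ⟨hx.1.le, hx.2⟩), mul_one, Real.norm_of_nonneg (h0 x)]
      _ ≤ _ := by
          refine setIntegral_le_integral (integrable_of_abs_support (L := 2 * R)
            (hc.mul (cψ.mul cχ)) fun x hx => by simp [c5 x hx])
            (Eventually.of_forall fun x => ?_)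
          exact (mul_nonneg (h0 x) (c4 x)).trans_eq (mul_assoc _ _ _)
  calc _ ≤ _ := h1
    _ = 2 / T * (T / 2 * ∫ x, p0 x * ((√(1 + x ^ 2))⁻¹ * χ R x)) := by field_simp
    _ ≤ _ := by gcongr; exact est R hR

/-! ### The Green integral as a classical solution -/

noncomputable section

/-- A dominating function for the heat kernels with `|x| ≤ M` and `0 < t ≤ T`. -/
def greenBound (d T M y : ℝ) : ℝ :=
  Real.exp (M ^ 2 / (4 * d * T)) *
    (Real.exp (-(M - y) ^ 2 / (4 * d * T)) + Real.exp (-(-M - y) ^ 2 / (4 * d * T)))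

/-- The moments of the unnormalized heat kernel against `g`. -/
def greenMoment (d : ℝ) (g : ℝ → ℝ) (n : ℕ) (x t : ℝ) : ℝ :=
  ∫ y, (x - y) ^ n * Real.exp (-(x - y) ^ 2 / (4 * d * t)) * g y

end

lemma greenBound_nonneg (d T M y : ℝ) : 0 ≤ greenBound d T M y := by
  unfold greenBound; positivity

/-- The kernel increases with `t`, and `-(x - y)² ≤ M² - (M - y)²` for `y ≥ 0`, symmetrically with
`-M` for `y < 0`. The two Gaussians at time `T` are integrable against the datum by `GreenConverges`
itself, so no growth bound on the datum is needed. -/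
lemma exp_le_greenBound {d T M x t : ℝ} (hd : 0 < d) (ht : 0 < t) (htT : t ≤ T) (hx : |x| ≤ M)
    (y : ℝ) : Real.exp (-(x - y) ^ 2 / (4 * d * t)) ≤ greenBound d T M y := by
  have hT : 0 < T := ht.trans_le htT
  obtain ⟨hx1, hx2⟩ := abs_le.1 hx
  have h1 : Real.exp (-(x - y) ^ 2 / (4 * d * t)) ≤ Real.exp (-(x - y) ^ 2 / (4 * d * T)) := by
    apply Real.exp_le_exp.2
    rw [neg_div, neg_div, neg_le_neg_iff]
    gcongr
  refine h1.trans ?_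
  unfold greenBound
  rw [mul_add, ← Real.exp_add, ← Real.exp_add, ← add_div, ← add_div]
  rcases le_or_gt 0 y with hy | hy
  · refine le_add_of_le_of_nonneg (Real.exp_le_exp.2 ?_) (Real.exp_nonneg _)
    gcongr
    nlinarith [sq_nonneg x]
  · refine le_add_of_nonneg_of_le (Real.exp_nonneg _) (Real.exp_le_exp.2 ?_)
    gcongr
    nlinarith [sq_nonneg x]

lemma GreenConverges.integrable_greenBound_mul {d T : ℝ} {g : ℝ → ℝ} (h : GreenConverges d T g)
    (hT : 0 < T) (M : ℝ) : Integrable fun y => greenBound d T M y * g y := by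
  have := ((h M T ⟨hT, le_rfl⟩).add (h (-M) T ⟨hT, le_rfl⟩)).const_mul
    (Real.exp (M ^ 2 / (4 * d * T)))
  refine this.congr (Eventually.of_forall fun y => ?_)
  simp only [greenBound, Pi.add_apply]
  ring

/-- The gap between `1 / T'` and `1 / T` in the exponent pays for the quadratic factor. -/
lemma one_add_sq_mul_exp_le {d T T' : ℝ} (hd : 0 < d) (hT' : 0 < T') (hTT : T' < T) :
    ∃ C, 0 ≤ C ∧ ∀ t, 0 < t → t ≤ T' → ∀ z : ℝ,
      (1 + z ^ 2) * Real.exp (-z ^ 2 / (4 * d * t)) ≤ C * Real.exp (-z ^ 2 / (4 * d * T)) := by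
  have hT : 0 < T := hT'.trans hTT
  set c := 1 / (4 * d * T') - 1 / (4 * d * T) with hc
  have hc0 : 0 < c := by
    rw [hc, sub_pos]
    gcongr
  refine ⟨1 + 1 / c, by positivity, fun t ht htT z => ?_⟩
  have h1 : c * z ^ 2 + 1 ≤ Real.exp (c * z ^ 2) := Real.add_one_le_exp _
  have h3 : 1 + z ^ 2 ≤ (1 + 1 / c) * (c * z ^ 2 + 1) := by
    have : (1 + 1 / c) * (c * z ^ 2 + 1) = c * z ^ 2 + 1 + z ^ 2 + 1 / c := by field_simp; ring
    rw [this]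
    have : 0 ≤ c * z ^ 2 := by positivity
    have : 0 < 1 / c := by positivity
    linarith
  calc (1 + z ^ 2) * Real.exp (-z ^ 2 / (4 * d * t))
      ≤ (1 + 1 / c) * Real.exp (c * z ^ 2) * Real.exp (-z ^ 2 / (4 * d * T')) := by
        gcongr ?_ * Real.exp ?_
        · exact h3.trans (by gcongr)
        · rw [neg_div, neg_div, neg_le_neg_iff]
          gcongr
    _ = (1 + 1 / c) * Real.exp (-z ^ 2 / (4 * d * T)) := by
        rw [mul_assoc, ← Real.exp_add]
        congr 2
        rw [hc]; ring

lemma abs_pow_le_one_add_sq {n : ℕ} (hn : n ≤ 2) (z : ℝ) : |z ^ n| ≤ 1 + z ^ 2 := by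
  interval_cases n
  · simp; positivity
  · rw [pow_one, abs_le]; constructor <;> nlinarith [sq_nonneg (z - 1), sq_nonneg (z + 1)]
  · rw [abs_of_nonneg (by positivity)]; linarith

/-- A locally uniform integrable bound for the kernels of `greenMoment`. -/
lemma GreenConverges.exists_bound {d T : ℝ} {g : ℝ → ℝ} (hd : 0 < d) (h : GreenConverges d T g)
    {T' : ℝ} (hT' : 0 < T') (hTT : T' < T) (M : ℝ) :
    ∃ B : ℝ → ℝ, Integrable B ∧ ∀ n ≤ 2, ∀ x t, |x| ≤ M → 0 < t → t ≤ T' → ∀ y,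
      ‖(x - y) ^ n * Real.exp (-(x - y) ^ 2 / (4 * d * t)) * g y‖ ≤ B y := by
  obtain ⟨C, hC0, hC⟩ := one_add_sq_mul_exp_le hd hT' hTT
  have hT : 0 < T := hT'.trans hTT
  refine ⟨fun y => C * ‖greenBound d T M y * g y‖,
    (h.integrable_greenBound_mul hT M).norm.const_mul C, fun n hn x t hx ht htT y => ?_⟩
  beta_reduce
  rw [norm_mul, norm_mul, norm_mul, Real.norm_of_nonneg (greenBound_nonneg _ _ _ _),
    Real.norm_of_nonneg (Real.exp_nonneg _), ← mul_assoc]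
  refine mul_le_mul_of_nonneg_right ?_ (norm_nonneg _)
  calc ‖(x - y) ^ n‖ * Real.exp (-(x - y) ^ 2 / (4 * d * t))
      ≤ (1 + (x - y) ^ 2) * Real.exp (-(x - y) ^ 2 / (4 * d * t)) := by
        gcongr; exact abs_pow_le_one_add_sq hn _
    _ ≤ C * Real.exp (-(x - y) ^ 2 / (4 * d * T)) := hC t ht htT _
    _ ≤ _ := by gcongr; exact exp_le_greenBound hd hT le_rfl hx y

lemma continuous_greenKernel_mul {g : ℝ → ℝ} (hg : Continuous g) (d : ℝ) (n : ℕ) (x t : ℝ) :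
    Continuous fun y => (x - y) ^ n * Real.exp (-(x - y) ^ 2 / (4 * d * t)) * g y := by
  fun_prop

lemma continuousAt_greenKernel_mul {d : ℝ} (hd : 0 < d) (g : ℝ → ℝ) (n : ℕ) (y : ℝ) {z : ℝ × ℝ}
    (hz : 0 < z.2) : ContinuousAt (fun z : ℝ × ℝ =>
      (z.1 - y) ^ n * Real.exp (-(z.1 - y) ^ 2 / (4 * d * z.2)) * g y) z := by
  have : 4 * d * z.2 ≠ 0 := by positivity
  fun_prop (disch := assumption)

lemma GreenConverges.continuousOn_greenMoment {d T : ℝ} {g : ℝ → ℝ} (hd : 0 < d)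
    (hg : Continuous g) (h : GreenConverges d T g) {n : ℕ} (hn : n ≤ 2) :
    ContinuousOn (fun z : ℝ × ℝ => greenMoment d g n z.1 z.2) (univ ×ˢ Ioo 0 T) := by
  rintro ⟨x₀, t₀⟩ ⟨-, ht⟩
  simp only at ht
  obtain ⟨T', h1, h2⟩ := exists_between ht.2
  obtain ⟨B, hB, hBd⟩ := h.exists_bound hd (ht.1.trans h1) h2 (|x₀| + 1)
  have hnhds : {z : ℝ × ℝ | |z.1| < |x₀| + 1 ∧ z.2 ∈ Ioo 0 T'} ∈ 𝓝 (x₀, t₀) := by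
    refine IsOpen.mem_nhds ?_ ⟨by simp, ht.1, h1⟩
    exact (isOpen_lt (continuous_abs.comp continuous_fst) continuous_const).inter (isOpen_Ioo.preimage continuous_snd)
  refine ContinuousAt.continuousWithinAt ?_
  refine continuousAt_of_dominated (bound := B) ?_ ?_ hB ?_
  · exact Eventually.of_forall fun z => (continuous_greenKernel_mul hg d n _ _).aestronglyMeasurable
  · filter_upwards [hnhds] with z hz
    exact Eventually.of_forall fun y => hBd n hn _ _ hz.1.le hz.2.1 hz.2.2.le y
  · exact Eventually.of_forall fun y => continuousAt_greenKernel_mul hd g n y ht.1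

/-- The zeroth moment has no polynomial factor to absorb, so `greenBound` dominates it up to and
including `t = T`. -/
lemma GreenConverges.continuousOn_greenMoment_zero {d T : ℝ} {g : ℝ → ℝ} (hd : 0 < d)
    (hg : Continuous g) (h : GreenConverges d T g) :
    ContinuousOn (fun z : ℝ × ℝ => greenMoment d g 0 z.1 z.2) (univ ×ˢ Ioc 0 T) := by
  rintro ⟨x₀, t₀⟩ ⟨-, ht⟩
  simp only at ht
  have hT : 0 < T := ht.1.trans_le ht.2
  have hnhds : {z : ℝ × ℝ | |z.1| < |x₀| + 1} ∈ 𝓝 (x₀, t₀) :=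
    (isOpen_lt (continuous_abs.comp continuous_fst) continuous_const).mem_nhds (by simp)
  refine continuousWithinAt_of_dominated
    (bound := fun y => ‖greenBound d T (|x₀| + 1) y * g y‖) ?_ ?_
    (h.integrable_greenBound_mul hT _).norm ?_
  · exact Eventually.of_forall fun z => (continuous_greenKernel_mul hg d 0 _ _).aestronglyMeasurable
  · filter_upwards [mem_nhdsWithin_of_mem_nhds hnhds, self_mem_nhdsWithin] with z hz hz'
    refine Eventually.of_forall fun y => ?_
    rw [pow_zero, one_mul, norm_mul, norm_mul, Real.norm_of_nonneg (greenBound_nonneg _ _ _ _),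
      Real.norm_of_nonneg (Real.exp_nonneg _)]
    gcongr
    exact exp_le_greenBound hd hz'.2.1 hz'.2.2 hz.le y
  · exact Eventually.of_forall fun y =>
      (continuousAt_greenKernel_mul hd g 0 y ht.1).continuousWithinAt

lemma hasDerivAt_greenKernel_space {d t : ℝ} (hd : 0 < d) (ht : 0 < t) (x y : ℝ) :
    HasDerivAt (fun x => Real.exp (-(x - y) ^ 2 / (4 * d * t)))
      (-(x - y) / (2 * d * t) * Real.exp (-(x - y) ^ 2 / (4 * d * t))) x := by
  have h1 : HasDerivAt (fun x : ℝ => (x - y) ^ 2) (2 * (x - y)) x := by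
    exact (((hasDerivAt_id x).sub_const y).pow 2).congr_deriv (by simp)
  refine ((h1.neg.div_const (4 * d * t)).exp).congr_deriv ?_
  simp only [Pi.neg_apply]
  field_simp
  ring

lemma hasDerivAt_greenKernel_time {d t : ℝ} (hd : 0 < d) (ht : 0 < t) (x y : ℝ) :
    HasDerivAt (fun t => Real.exp (-(x - y) ^ 2 / (4 * d * t)))
      ((x - y) ^ 2 / (4 * d * t ^ 2) * Real.exp (-(x - y) ^ 2 / (4 * d * t))) t := by
  have h1 : HasDerivAt (fun t : ℝ => 4 * d * t) (4 * d) t := by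
    simpa using (hasDerivAt_id t).const_mul (4 * d)
  refine (((hasDerivAt_const t (-(x - y) ^ 2)).div h1 (by positivity)).exp).congr_deriv ?_
  simp only [Pi.div_apply]
  field_simp
  ring

lemma GreenConverges.integrable_moment {d T : ℝ} {g : ℝ → ℝ} (hd : 0 < d) (hg : Continuous g)
    (h : GreenConverges d T g) {n : ℕ} (hn : n ≤ 2) (x : ℝ) {t : ℝ} (ht : t ∈ Ioo 0 T) :
    Integrable fun y => (x - y) ^ n * Real.exp (-(x - y) ^ 2 / (4 * d * t)) * g y := by
  obtain ⟨B, hB, hBd⟩ := h.exists_bound hd ht.1 ht.2 |x|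
  exact hB.mono' (continuous_greenKernel_mul hg d n x t).aestronglyMeasurable
    (Eventually.of_forall fun y => hBd n hn x t le_rfl ht.1 le_rfl y)

/-- Differentiating the kernel multiplies it by polynomials in `x - y`, so all the derivatives
needed are combinations of the moments `0`, `1`, `2`. -/
lemma GreenConverges.hasDerivAt_greenMoment_zero {d T : ℝ} {g : ℝ → ℝ} (hd : 0 < d)
    (hg : Continuous g) (h : GreenConverges d T g) (x : ℝ) {t : ℝ} (ht : t ∈ Ioo 0 T) :
    HasDerivAt (fun x => greenMoment d g 0 x t) (-1 / (2 * d * t) * greenMoment d g 1 x t) x := by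
  obtain ⟨B, hB, hBd⟩ := h.exists_bound hd ht.1 ht.2 (|x| + 1)
  have ht0 := ht.1
  unfold greenMoment
  rw [← integral_const_mul]
  refine (hasDerivAt_integral_of_dominated_loc_of_deriv_le (F := fun x y =>
    (x - y) ^ 0 * Real.exp (-(x - y) ^ 2 / (4 * d * t)) * g y) (F' := fun x y => -1 / (2 * d * t) *
      ((x - y) ^ 1 * Real.exp (-(x - y) ^ 2 / (4 * d * t)) * g y))
    (bound := fun y => |-1 / (2 * d * t)| * B y)
    ((isOpen_lt continuous_abs continuous_const).mem_nhds (by simp : |x| < |x| + 1))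
    ?_ ?_ ?_ ?_ ?_ ?_).2
  · exact Eventually.of_forall fun z => (continuous_greenKernel_mul hg d 0 _ _).aestronglyMeasurable
  · exact h.integrable_moment hd hg (by norm_num) x ht
  · exact (continuous_const.mul (continuous_greenKernel_mul hg d 1 _ _)).aestronglyMeasurable
  · refine Eventually.of_forall fun y z hz => ?_
    rw [norm_mul, Real.norm_eq_abs]
    gcongr
    exact hBd 1 (by norm_num) z t (le_of_lt hz) ht.1 le_rfl y
  · exact hB.const_mul _
  · refine Eventually.of_forall fun y z _ => ?_
    simp only [pow_zero, one_mul, pow_one]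
    exact ((hasDerivAt_greenKernel_space hd ht.1 z y).mul_const (g y)).congr_deriv (by ring)

lemma GreenConverges.hasDerivAt_greenMoment_one {d T : ℝ} {g : ℝ → ℝ} (hd : 0 < d)
    (hg : Continuous g) (h : GreenConverges d T g) (x : ℝ) {t : ℝ} (ht : t ∈ Ioo 0 T) :
    HasDerivAt (fun x => greenMoment d g 1 x t)
      (greenMoment d g 0 x t - 1 / (2 * d * t) * greenMoment d g 2 x t) x := by
  obtain ⟨B, hB, hBd⟩ := h.exists_bound hd ht.1 ht.2 (|x| + 1)
  have ht0 := ht.1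
  unfold greenMoment
  rw [← integral_const_mul, ← integral_sub (h.integrable_moment hd hg (by norm_num) x ht)
    ((h.integrable_moment hd hg (by norm_num) x ht).const_mul _)]
  refine (hasDerivAt_integral_of_dominated_loc_of_deriv_le (F := fun x y =>
    (x - y) ^ 1 * Real.exp (-(x - y) ^ 2 / (4 * d * t)) * g y) (F' := fun x y =>
      (x - y) ^ 0 * Real.exp (-(x - y) ^ 2 / (4 * d * t)) * g y - 1 / (2 * d * t) *
      ((x - y) ^ 2 * Real.exp (-(x - y) ^ 2 / (4 * d * t)) * g y))
    (bound := fun y => B y + |1 / (2 * d * t)| * B y)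
    ((isOpen_lt continuous_abs continuous_const).mem_nhds (by simp : |x| < |x| + 1))
    ?_ ?_ ?_ ?_ ?_ ?_).2
  · exact Eventually.of_forall fun z => (continuous_greenKernel_mul hg d 1 _ _).aestronglyMeasurable
  · exact h.integrable_moment hd hg (by norm_num) x ht
  · exact ((continuous_greenKernel_mul hg d 0 _ _).sub
      (continuous_const.mul (continuous_greenKernel_mul hg d 2 _ _))).aestronglyMeasurable
  · refine Eventually.of_forall fun y z hz => (norm_sub_le _ _).trans ?_
    rw [norm_mul (1 / (2 * d * t)), Real.norm_eq_abs (1 / (2 * d * t))]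
    gcongr
    · exact hBd 0 (by norm_num) z t (le_of_lt hz) ht.1 le_rfl y
    · exact hBd 2 (by norm_num) z t (le_of_lt hz) ht.1 le_rfl y
  · exact hB.add (hB.const_mul _)
  · refine Eventually.of_forall fun y z _ => ?_
    simp only [pow_zero, one_mul, pow_one]
    exact ((((hasDerivAt_id z).sub_const y).mul
      (hasDerivAt_greenKernel_space hd ht.1 z y)).mul_const (g y)).congr_deriv
      (by simp only [id]; ring)

lemma GreenConverges.hasDerivAt_greenMoment_time {d T : ℝ} {g : ℝ → ℝ} (hd : 0 < d)
    (hg : Continuous g) (h : GreenConverges d T g) (x : ℝ) {t : ℝ} (ht : t ∈ Ioo 0 T) :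
    HasDerivAt (fun t => greenMoment d g 0 x t)
      (1 / (4 * d * t ^ 2) * greenMoment d g 2 x t) t := by
  obtain ⟨T', h1, h2⟩ := exists_between ht.2
  obtain ⟨B, hB, hBd⟩ := h.exists_bound hd (ht.1.trans h1) h2 |x|
  have ht0 := ht.1
  -- The lower end controls `1 / s²`, the upper end keeps the moment bound available.
  have hmem : t ∈ Ioo (t / 2) T' := ⟨by linarith, h1⟩
  unfold greenMoment
  rw [← integral_const_mul]
  refine (hasDerivAt_integral_of_dominated_loc_of_deriv_le (F := fun t y =>
    (x - y) ^ 0 * Real.exp (-(x - y) ^ 2 / (4 * d * t)) * g y) (F' := fun t y =>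
      1 / (4 * d * t ^ 2) * ((x - y) ^ 2 * Real.exp (-(x - y) ^ 2 / (4 * d * t)) * g y))
    (bound := fun y => 1 / (4 * d * (t / 2) ^ 2) * B y) (isOpen_Ioo.mem_nhds hmem)
    ?_ ?_ ?_ ?_ ?_ ?_).2
  · exact Eventually.of_forall fun z => (continuous_greenKernel_mul hg d 0 _ _).aestronglyMeasurable
  · exact h.integrable_moment hd hg (by norm_num) x ht
  · exact (continuous_const.mul (continuous_greenKernel_mul hg d 2 _ _)).aestronglyMeasurable
  · refine Eventually.of_forall fun y s hs => ?_
    have hs0 : 0 < s := by linarith [hs.1]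
    rw [norm_mul, Real.norm_of_nonneg (by positivity : 0 ≤ 1 / (4 * d * s ^ 2))]
    have := hs.1.le
    gcongr
    exact hBd 2 le_rfl x s le_rfl hs0 hs.2.le y
  · exact hB.const_mul _
  · refine Eventually.of_forall fun y s hs => ?_
    have hs0 : 0 < s := by linarith [hs.1]
    simp only [pow_zero, one_mul]
    exact ((hasDerivAt_greenKernel_time hd hs0 x y).mul_const (g y)).congr_deriv (by ring)

noncomputable section

/-- The normalization of the heat kernel. -/
def greenScale (d t : ℝ) : ℝ := 1 / (2 * √(Real.pi * d * t))

end

lemma greenHeat_of_pos {d t : ℝ} (ht : 0 < t) (g : ℝ → ℝ) (x : ℝ) :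
    greenHeat d g x t = greenScale d t * greenMoment d g 0 x t := by
  simp [greenHeat, greenScale, greenMoment, ht.ne']

lemma greenScale_nonneg (d t : ℝ) : 0 ≤ greenScale d t := by unfold greenScale; positivity

lemma continuousOn_greenScale {d : ℝ} (hd : 0 < d) : ContinuousOn (greenScale d) (Ioi 0) := by
  unfold greenScale
  refine ContinuousOn.div (by fun_prop) (by fun_prop) fun t ht => ?_
  have : 0 < t := ht
  positivity

lemma hasDerivAt_greenScale {d t : ℝ} (hd : 0 < d) (ht : 0 < t) :
    HasDerivAt (greenScale d) (-1 / (2 * t) * greenScale d t) t := by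
  have h0 : 0 < Real.pi * d * t := by positivity
  have h1 : HasDerivAt (fun t : ℝ => Real.pi * d * t) (Real.pi * d) t :=
    ((hasDerivAt_id t).const_mul (Real.pi * d)).congr_deriv (mul_one _)
  have h2 := ((h1.sqrt h0.ne').const_mul 2)
  have hs : √(Real.pi * d * t) ≠ 0 := by positivity
  have hsq : √(Real.pi * d * t) ^ 2 = Real.pi * d * t := Real.sq_sqrt h0.le
  refine ((hasDerivAt_const t (1 : ℝ)).div h2 (by positivity)).congr_deriv ?_
  simp only [greenScale]
  field_simp
  rw [hsq]
  ring

lemma GreenConverges.hasDerivAt_greenHeat_space {d T : ℝ} {g : ℝ → ℝ} (hd : 0 < d)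
    (hg : Continuous g) (h : GreenConverges d T g) (x : ℝ) {t : ℝ} (ht : t ∈ Ioo 0 T) :
    HasDerivAt (fun x => greenHeat d g x t)
      (greenScale d t * (-1 / (2 * d * t) * greenMoment d g 1 x t)) x := by
  simp only [greenHeat_of_pos ht.1]
  exact (h.hasDerivAt_greenMoment_zero hd hg x ht).const_mul _

lemma GreenConverges.spaceDeriv_greenHeat {d T : ℝ} {g : ℝ → ℝ} (hd : 0 < d)
    (hg : Continuous g) (h : GreenConverges d T g) (x : ℝ) {t : ℝ} (ht : t ∈ Ioo 0 T) :
    spaceDeriv (greenHeat d g) x t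
      = greenScale d t * (-1 / (2 * d * t) * greenMoment d g 1 x t) :=
  (h.hasDerivAt_greenHeat_space hd hg x ht).deriv

lemma GreenConverges.hasDerivAt_spaceDeriv_greenHeat {d T : ℝ} {g : ℝ → ℝ} (hd : 0 < d)
    (hg : Continuous g) (h : GreenConverges d T g) (x : ℝ) {t : ℝ} (ht : t ∈ Ioo 0 T) :
    HasDerivAt (fun x => spaceDeriv (greenHeat d g) x t)
      (greenScale d t * (-1 / (2 * d * t) *
        (greenMoment d g 0 x t - 1 / (2 * d * t) * greenMoment d g 2 x t))) x := by
  simp only [h.spaceDeriv_greenHeat hd hg _ ht]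
  exact ((h.hasDerivAt_greenMoment_one hd hg x ht).const_mul _).const_mul _

lemma GreenConverges.spaceDeriv_two_greenHeat {d T : ℝ} {g : ℝ → ℝ} (hd : 0 < d)
    (hg : Continuous g) (h : GreenConverges d T g) (x : ℝ) {t : ℝ} (ht : t ∈ Ioo 0 T) :
    spaceDeriv (spaceDeriv (greenHeat d g)) x t
      = greenScale d t * (-1 / (2 * d * t) *
        (greenMoment d g 0 x t - 1 / (2 * d * t) * greenMoment d g 2 x t)) :=
  (h.hasDerivAt_spaceDeriv_greenHeat hd hg x ht).deriv

/-- The derivative of the normalization supplies the zeroth-moment term of `d h_xx`, that of the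
kernel the second-moment term. -/
lemma GreenConverges.hasDerivAt_greenHeat_time {d T : ℝ} {g : ℝ → ℝ} (hd : 0 < d)
    (hg : Continuous g) (h : GreenConverges d T g) (x : ℝ) {t : ℝ} (ht : t ∈ Ioo 0 T) :
    HasDerivAt (fun t => greenHeat d g x t)
      (d * spaceDeriv (spaceDeriv (greenHeat d g)) x t) t := by
  have ht0 := ht.1
  have he : (fun t => greenHeat d g x t) =ᶠ[𝓝 t]
      fun t => greenScale d t * greenMoment d g 0 x t := by
    filter_upwards [lt_mem_nhds ht.1] with s hs using greenHeat_of_pos hs g x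
  refine (((hasDerivAt_greenScale hd ht.1).mul
    (h.hasDerivAt_greenMoment_time hd hg x ht)).congr_of_eventuallyEq he).congr_deriv ?_
  rw [h.spaceDeriv_two_greenHeat hd hg x ht]
  field_simp
  ring

lemma integrable_greenKernel {d t : ℝ} (hd : 0 < d) (ht : 0 < t) (x : ℝ) :
    Integrable fun y => Real.exp (-(x - y) ^ 2 / (4 * d * t)) := by
  have := (integrable_exp_neg_mul_sq (b := 1 / (4 * d * t)) (by positivity)).comp_sub_left x
  refine this.congr (Eventually.of_forall fun y => ?_)
  simp only
  congr 1
  ring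

lemma greenScale_mul_integral {d t : ℝ} (hd : 0 < d) (ht : 0 < t) (x : ℝ) :
    greenScale d t * ∫ y, Real.exp (-(x - y) ^ 2 / (4 * d * t)) = 1 := by
  have h1 : ∫ y, Real.exp (-(x - y) ^ 2 / (4 * d * t)) = √(Real.pi / (1 / (4 * d * t))) := by
    rw [← integral_gaussian, ← integral_sub_left_eq_self (fun y => Real.exp _) _ x]
    refine integral_congr_ae (Eventually.of_forall fun y => ?_)
    simp only
    congr 1
    ring
  have h2 : Real.pi / (1 / (4 * d * t)) = 2 ^ 2 * (Real.pi * d * t) := by field_simp; norm_num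
  rw [h1, h2, Real.sqrt_mul (by positivity), Real.sqrt_sq (by norm_num), greenScale]
  have : √(Real.pi * d * t) ≠ 0 := by positivity
  field_simp

lemma greenConverges_const {d : ℝ} (hd : 0 < d) (T c : ℝ) : GreenConverges d T fun _ => c :=
  fun x _ ht => (integrable_greenKernel hd ht.1 x).mul_const c

/-- Quantitative convergence of the Green integral to its initial datum. -/
lemma GreenConverges.abs_greenHeat_sub_le {d T : ℝ} {g : ℝ → ℝ} (hd : 0 < d) (hT : 0 < T)
    (h : GreenConverges d T g) {x₀ r ε : ℝ} (hr : 0 < r)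
    (hε : ∀ y, |y - x₀| < r → |g y - g x₀| ≤ ε) :
    ∃ Q, 0 ≤ Q ∧ ∀ x t, |x - x₀| ≤ r / 2 → 0 < t → 2 * t ≤ T →
      |greenHeat d g x t - g x₀| ≤ ε + greenScale d t * (t * Q) := by
  set M := |x₀| + r with hM
  have hb : Integrable fun y => greenBound d T M y * |g y - g x₀| := by
    have h1 : Integrable fun y => greenBound d T M y * (g y - g x₀) := by
      refine ((h.integrable_greenBound_mul hT M).sub
        ((greenConverges_const hd T (g x₀)).integrable_greenBound_mul hT M)).congr
        (Eventually.of_forall fun y => ?_)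
      simp only [Pi.sub_apply]; ring
    refine h1.norm.congr (Eventually.of_forall fun y => ?_)
    simp only [norm_mul, Real.norm_of_nonneg (greenBound_nonneg d T M y), Real.norm_eq_abs]
  set q := ∫ y, greenBound d T M y * |g y - g x₀| with hq
  have hq0 : 0 ≤ q := integral_nonneg fun y => mul_nonneg (greenBound_nonneg _ _ _ _) (abs_nonneg _)
  refine ⟨32 * d / r ^ 2 * q, by positivity, fun x t hx ht htT => ?_⟩
  have hxM : |x| ≤ M := by
    have := abs_sub_abs_le_abs_sub x x₀
    rw [hM]; linarith
  have hsc := greenScale_nonneg d t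
  have iK := integrable_greenKernel hd ht x
  have ig := h x t ⟨ht, by linarith⟩
  have hε0 : 0 ≤ ε := (abs_nonneg _).trans (hε x₀ (by simpa using hr))
  have e1 : greenHeat d g x t - g x₀
      = greenScale d t * ∫ y, Real.exp (-(x - y) ^ 2 / (4 * d * t)) * (g y - g x₀) := by
    have : ∫ y, Real.exp (-(x - y) ^ 2 / (4 * d * t)) * (g y - g x₀)
        = (∫ y, Real.exp (-(x - y) ^ 2 / (4 * d * t)) * g y)
          - (∫ y, Real.exp (-(x - y) ^ 2 / (4 * d * t))) * g x₀ := by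
      rw [← integral_mul_const, ← integral_sub ig (iK.mul_const _)]
      refine integral_congr_ae (Eventually.of_forall fun y => ?_)
      simp only; ring
    rw [this, mul_sub, ← mul_assoc, greenScale_mul_integral hd ht, one_mul, greenHeat_of_pos ht]
    simp [greenMoment]
  have pt : ∀ y, ‖Real.exp (-(x - y) ^ 2 / (4 * d * t)) * (g y - g x₀)‖
      ≤ Real.exp (-(x - y) ^ 2 / (4 * d * t)) * ε
        + 32 * d * t / r ^ 2 * (greenBound d T M y * |g y - g x₀|) := fun y => by
    rw [norm_mul, Real.norm_of_nonneg (Real.exp_nonneg _), Real.norm_eq_abs]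
    have hB := greenBound_nonneg d T M y
    rcases lt_or_ge |y - x₀| r with hy | hy
    · refine le_add_of_le_of_nonneg ?_ (by positivity)
      gcongr
      exact hε y hy
    · refine le_add_of_nonneg_of_le (by positivity) ?_
      rw [← mul_assoc]
      refine mul_le_mul_of_nonneg_right ?_ (abs_nonneg _)
      have hxy : r / 2 ≤ |x - y| := by
        have := abs_sub_le y x x₀
        rw [abs_sub_comm x y]
        linarith
      have hsq : (r / 2) ^ 2 ≤ (x - y) ^ 2 := by
        rw [← sq_abs (x - y)]; gcongr
      -- Far from `x₀` the exponent is halved. One half gives a factor `O(t)` through `e^{-s} ≤ 1 /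
      -- s`; the other is the kernel at time `2t ≤ T`, dominated by `greenBound`.
      have hexp : Real.exp (-(x - y) ^ 2 / (4 * d * t))
          = Real.exp (-((x - y) ^ 2 / (8 * d * t)))
            * Real.exp (-(x - y) ^ 2 / (4 * d * (2 * t))) := by
        rw [← Real.exp_add]; congr 1; field_simp; ring
      rw [hexp]
      refine mul_le_mul ?_ (exp_le_greenBound hd (by linarith) htT hxM y) (Real.exp_nonneg _)
        (by positivity)
      have hs : 0 < (x - y) ^ 2 / (8 * d * t) := by
        have : 0 < (x - y) ^ 2 := lt_of_lt_of_le (by positivity) hsq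
        positivity
      calc Real.exp (-((x - y) ^ 2 / (8 * d * t))) ≤ 1 / ((x - y) ^ 2 / (8 * d * t)) := by
            rw [Real.exp_neg, inv_eq_one_div]
            refine one_div_le_one_div_of_le hs ?_
            linarith [Real.add_one_le_exp ((x - y) ^ 2 / (8 * d * t))]
        _ ≤ 1 / ((r / 2) ^ 2 / (8 * d * t)) := by gcongr
        _ = 32 * d * t / r ^ 2 := by field_simp; norm_num
  have isum : Integrable fun y => Real.exp (-(x - y) ^ 2 / (4 * d * t)) * ε
      + 32 * d * t / r ^ 2 * (greenBound d T M y * |g y - g x₀|) :=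
    (iK.mul_const ε).add (hb.const_mul _)
  have hint := norm_integral_le_of_norm_le isum (Eventually.of_forall pt)
  rw [integral_add (iK.mul_const ε) (hb.const_mul _), integral_mul_const,
    integral_const_mul, ← hq] at hint
  rw [e1, abs_mul, abs_of_nonneg hsc]
  calc _ ≤ greenScale d t * ((∫ y, Real.exp (-(x - y) ^ 2 / (4 * d * t))) * ε
        + 32 * d * t / r ^ 2 * q) := by gcongr; exact hint
    _ = (greenScale d t * ∫ y, Real.exp (-(x - y) ^ 2 / (4 * d * t))) * ε
        + greenScale d t * (t * (32 * d / r ^ 2 * q)) := by ring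
    _ = _ := by rw [greenScale_mul_integral hd ht, one_mul]

/-- The scale is of order `t^{-1/2}`, so the error is of order `√t`. -/
lemma tendsto_greenScale_mul {d : ℝ} (hd : 0 < d) (Q : ℝ) :
    Tendsto (fun t => greenScale d t * (t * Q)) (𝓝[≥] 0) (𝓝 0) := by
  have hc : Continuous fun t : ℝ => √t * (Q / (2 * √(Real.pi * d))) := by fun_prop
  have := (hc.tendsto 0).mono_left (nhdsWithin_le_nhds (s := Ici 0))
  simp only [Real.sqrt_zero, zero_mul] at this
  refine this.congr' (eventually_mem_nhdsWithin.mono fun t ht => ?_)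
  have ht0 : (0 : ℝ) ≤ t := ht
  rcases ht0.eq_or_lt with h0 | h0
  · simp [← h0]
  have hs : √t ≠ 0 := by positivity
  have hs' : √(Real.pi * d) ≠ 0 := by positivity
  have ht2 : √t ^ 2 = t := Real.sq_sqrt ht0
  simp only [greenScale]
  rw [Real.sqrt_mul (by positivity) t]
  field_simp
  rw [ht2, mul_comm]

lemma GreenConverges.continuousOn_greenHeat {d T : ℝ} {g : ℝ → ℝ} (hd : 0 < d) (hT : 0 < T)
    (hg : Continuous g) (h : GreenConverges d T g) :
    ContinuousOn (fun z : ℝ × ℝ => greenHeat d g z.1 z.2) (univ ×ˢ Icc 0 T) := by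
  rintro ⟨x₀, t₀⟩ ⟨-, ht⟩
  simp only at ht
  rcases ht.1.eq_or_lt with h0 | h0
  · subst h0
    refine Metric.tendsto_nhds.2 fun ε hε => ?_
    obtain ⟨r, hr, hgr⟩ := Metric.continuous_iff.1 hg x₀ (ε / 2) (by positivity)
    obtain ⟨Q, hQ, hb⟩ := h.abs_greenHeat_sub_le hd hT hr (ε := ε / 2) fun y hy =>
      (hgr y hy).le
    have hlim := tendsto_greenScale_mul hd Q
    have hsnd : Tendsto Prod.snd (𝓝[univ ×ˢ Icc 0 T] (x₀, (0 : ℝ))) (𝓝[≥] 0) := by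
      refine tendsto_nhdsWithin_iff.2 ⟨continuous_snd.continuousAt.mono_left nhdsWithin_le_nhds, ?_⟩
      exact eventually_mem_nhdsWithin.mono fun z hz => hz.2.1
    have ev1 := (hlim.comp hsnd).eventually (gt_mem_nhds (half_pos hε))
    have ev2 : ∀ᶠ z in 𝓝[univ ×ˢ Icc 0 T] (x₀, (0 : ℝ)), |z.1 - x₀| < r / 2 ∧ z.2 < T / 2 := by
      refine nhdsWithin_le_nhds (IsOpen.mem_nhds (s := {z : ℝ × ℝ | |z.1 - x₀| < r / 2 ∧
        z.2 < T / 2}) ?_ ⟨by simpa using hr, by simpa using hT⟩)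
      exact (isOpen_lt (continuous_abs.comp (continuous_fst.sub continuous_const))
        continuous_const).inter (isOpen_lt continuous_snd continuous_const)
    filter_upwards [ev1, ev2, eventually_mem_nhdsWithin] with z h1 h2 h3
    have hx0 : greenHeat d g x₀ 0 = g x₀ := by simp [greenHeat]
    simp only [hx0, Real.dist_eq]
    -- Nearby points with `t = 0` use continuity of the datum, those with `t > 0` the quantitative
    -- estimate.
    rcases h3.2.1.eq_or_lt with hz | hz
    · rw [← hz]
      simp only [greenHeat, if_true]
      have := hgr z.1 (by rw [Real.dist_eq]; linarith [h2.1])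
      rw [Real.dist_eq] at this
      linarith
    · have := hb z.1 z.2 h2.1.le hz (by linarith [h2.2])
      simp only [Function.comp_apply] at h1
      linarith
  · have hc : ContinuousOn (fun z : ℝ × ℝ => greenScale d z.2 * greenMoment d g 0 z.1 z.2)
        (univ ×ˢ Ioc 0 T) :=
      ((continuousOn_greenScale hd).comp continuousOn_snd fun z hz => hz.2.1).mul
        (h.continuousOn_greenMoment_zero hd hg)
    have hc' : ContinuousWithinAt (fun z : ℝ × ℝ => greenHeat d g z.1 z.2)
        (univ ×ˢ Ioc 0 T) (x₀, t₀) := (hc (x₀, t₀) ⟨mem_univ _, h0, ht.2⟩).congr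
      (fun z hz => greenHeat_of_pos hz.2.1 g z.1) (greenHeat_of_pos h0 g x₀)
    refine hc'.mono_of_mem_nhdsWithin ?_
    have hn : {z : ℝ × ℝ | 0 < z.2} ∈ 𝓝 (x₀, t₀) :=
      (isOpen_lt continuous_const continuous_snd).mem_nhds h0
    filter_upwards [mem_nhdsWithin_of_mem_nhds hn, self_mem_nhdsWithin] with z h1 h2
    exact ⟨mem_univ _, h1, h2.2.2⟩

/-- The Green integral is a classical solution of the heat equation. -/
theorem GreenConverges.isHeatSolution {d T : ℝ} {g : ℝ → ℝ} (hd : 0 < d) (hT : 0 < T)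
    (hg : Continuous g) (h : GreenConverges d T g) : IsHeatSolution d T g (greenHeat d g) := by
  have cs : ContinuousOn (fun z : ℝ × ℝ => greenScale d z.2) (univ ×ˢ Ioo 0 T) :=
    (continuousOn_greenScale hd).comp continuousOn_snd fun z hz => hz.2.1
  have c1 : ContinuousOn (fun z : ℝ × ℝ => -1 / (2 * d * z.2)) (univ ×ˢ Ioo 0 T) :=
    ContinuousOn.div (by fun_prop) (by fun_prop) fun z hz => by
      have := hz.2.1; positivity
  have c2 : ContinuousOn (fun z : ℝ × ℝ => 1 / (2 * d * z.2)) (univ ×ˢ Ioo 0 T) :=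
    ContinuousOn.div (by fun_prop) (by fun_prop) fun z hz => by
      have := hz.2.1; positivity
  have cxx : ContinuousOn (fun z : ℝ × ℝ => spaceDeriv (spaceDeriv (greenHeat d g)) z.1 z.2)
      (univ ×ˢ Ioo 0 T) := by
    refine ContinuousOn.congr (cs.mul (c1.mul ((h.continuousOn_greenMoment hd hg
      (n := 0) (by norm_num)).sub (c2.mul (h.continuousOn_greenMoment hd hg (n := 2) le_rfl)))))
      fun z hz => ?_
    exact h.spaceDeriv_two_greenHeat hd hg z.1 hz.2
  have heq : ∀ x, ∀ t ∈ Ioo 0 T, timeDeriv (greenHeat d g) x t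
      = d * spaceDeriv (spaceDeriv (greenHeat d g)) x t := fun x t ht =>
    (h.hasDerivAt_greenHeat_time hd hg x ht).deriv
  refine ⟨⟨h.continuousOn_greenHeat hd hT hg,
    fun x t ht => (h.hasDerivAt_greenHeat_time hd hg x ht).differentiableAt,
    fun x t ht => (h.hasDerivAt_greenHeat_space hd hg x ht).differentiableAt,
    fun x t ht => (h.hasDerivAt_spaceDeriv_greenHeat hd hg x ht).differentiableAt,
    ?_, ?_, cxx⟩, heq, fun x => by simp [greenHeat]⟩
  · exact (cxx.const_smul d).congr fun z hz => heq z.1 z.2 hz.2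
  · refine ContinuousOn.congr (cs.mul (c1.mul (h.continuousOn_greenMoment hd hg
      (n := 1) (by norm_num)))) fun z hz => ?_
    exact h.spaceDeriv_greenHeat hd hg z.1 hz.2

/-! ### Comparison of the state with the Green integral -/

lemma IsClassical.exp_mul_sub {T k : ℝ} {p h : ℝ → ℝ → ℝ} (hp : IsClassical T p)
    (hh : IsClassical T h) : IsClassical T (fun x t => Real.exp (-k * t) * p x t - h x t) ∧
    (∀ x, ∀ t ∈ Ioo 0 T, timeDeriv (fun x t => Real.exp (-k * t) * p x t - h x t) x t
      = Real.exp (-k * t) * (timeDeriv p x t - k * p x t) - timeDeriv h x t) ∧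
    ∀ x, ∀ t ∈ Ioo 0 T, spaceDeriv (spaceDeriv fun x t => Real.exp (-k * t) * p x t - h x t) x t
      = Real.exp (-k * t) * spaceDeriv (spaceDeriv p) x t - spaceDeriv (spaceDeriv h) x t := by
  set w : ℝ → ℝ → ℝ := fun x t => Real.exp (-k * t) * p x t - h x t with hw
  have d1 : ∀ x, ∀ t ∈ Ioo 0 T, HasDerivAt (fun s => w x s)
      (Real.exp (-k * t) * (timeDeriv p x t - k * p x t) - timeDeriv h x t) t := fun x t ht => by
    have he : HasDerivAt (fun s : ℝ => Real.exp (-k * s)) (-k * Real.exp (-k * t)) t :=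
      (((hasDerivAt_id t).const_mul (-k)).exp).congr_deriv (by simp; ring)
    exact ((he.mul (hp.diff_time x t ht).hasDerivAt).sub
      (hh.diff_time x t ht).hasDerivAt).congr_deriv (by simp only [timeDeriv]; ring)
  have d2 : ∀ x, ∀ t ∈ Ioo 0 T, HasDerivAt (fun y => w y t)
      (Real.exp (-k * t) * spaceDeriv p x t - spaceDeriv h x t) x := fun x t ht =>
    ((hp.diff_space x t ht).hasDerivAt.const_mul _).sub (hh.diff_space x t ht).hasDerivAt
  have e2 : ∀ x, ∀ t ∈ Ioo 0 T, spaceDeriv w x t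
      = Real.exp (-k * t) * spaceDeriv p x t - spaceDeriv h x t := fun x t ht => (d2 x t ht).deriv
  have d3 : ∀ x, ∀ t ∈ Ioo 0 T, HasDerivAt (fun y => spaceDeriv w y t)
      (Real.exp (-k * t) * spaceDeriv (spaceDeriv p) x t - spaceDeriv (spaceDeriv h) x t) x :=
    fun x t ht => by
      simp only [e2 _ t ht]
      exact ((hp.diff_space_two x t ht).hasDerivAt.const_mul _).sub
        (hh.diff_space_two x t ht).hasDerivAt
  have ce : Continuous fun z : ℝ × ℝ => Real.exp (-k * z.2) := by fun_prop
  refine ⟨⟨(ce.continuousOn.mul hp.cont).sub hh.cont,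
    fun x t ht => (d1 x t ht).differentiableAt, fun x t ht => (d2 x t ht).differentiableAt,
    fun x t ht => (d3 x t ht).differentiableAt, ?_, ?_, ?_⟩,
    fun x t ht => (d1 x t ht).deriv, fun x t ht => (d3 x t ht).deriv⟩
  · refine ((ce.continuousOn.mul (hp.cont_time.sub ((hp.cont.mono
      (prod_mono_right Ioo_subset_Icc_self)).const_smul k))).sub hh.cont_time).congr
      fun z hz => (d1 z.1 z.2 hz.2).deriv
  · exact ((ce.continuousOn.mul hp.cont_space).sub hh.cont_space).congr
      fun z hz => e2 z.1 z.2 hz.2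
  · exact ((ce.continuousOn.mul hp.cont_space_two).sub hh.cont_space_two).congr
      fun z hz => (d3 z.1 z.2 hz.2).deriv

lemma greenHeat_nonneg {d : ℝ} {g : ℝ → ℝ} (hg : ∀ x, 0 ≤ g x) (x t : ℝ) :
    0 ≤ greenHeat d g x t := by
  unfold greenHeat
  split_ifs
  · exact hg x
  · exact mul_nonneg (by positivity) (integral_nonneg fun y =>
      mul_nonneg (Real.exp_nonneg _) (hg y))

lemma IsOptimalWithTax.le_greenHeat {d η δ ρ θ T : ℝ} {p0 : ℝ → ℝ} {p u τ : ℝ → ℝ → ℝ} {τmin : ℝ}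
    (hd : 0 < d) (hη : 0 < η) (h : IsOptimalWithTax d η δ ρ θ T p0 p u τ τmin)
    (hp0 : ∀ x, 0 < p0 x) (hh : IsHeatSolution d T p0 (greenHeat d p0)) (x : ℝ) {t : ℝ}
    (ht : t ∈ Icc 0 T) :
    p x t ≤ Real.exp ((η - δ - η * τmin) * t) * greenHeat d p0 x t := by
  set k := η - δ - η * τmin with hk
  have hadm := h.optimal.admissible
  obtain ⟨hcl, ht1, ht2⟩ := hadm.classical.exp_mul_sub (k := k) hh.classical
  obtain ⟨a, ha, hgr⟩ := hadm.growth
  have hτ : ∀ x, ∀ t ∈ Icc 0 T, τmin ≤ τ x t := fun x t ht =>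
    h.tax_min.1 ⟨(x, t), ⟨mem_univ _, ht⟩, rfl⟩
  have hw := hcl.subsolution_nonpos hd ha ?_ ?_ ?_ ht x
  · have he : Real.exp (k * t) * Real.exp (-k * t) = 1 := by
      rw [← Real.exp_add]; simp
    have := mul_le_mul_of_nonneg_left (sub_nonpos.1 hw) (Real.exp_nonneg (k * t))
    rwa [← mul_assoc, he, one_mul] at this
  · intro x t ht
    have hI := Ioo_subset_Icc_self ht
    rw [ht1 x t ht, ht2 x t ht, hh.heat_eq x t ht, hadm.state_eq x t ht, h.tax x t hI]
    have h1 : 0 ≤ η * (p x t * (τ x t - τmin)) :=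
      mul_nonneg hη.le (mul_nonneg (h.p_nonneg x t hI) (sub_nonneg.2 (hτ x t hI)))
    have := mul_nonneg (Real.exp_nonneg (-k * t)) h1
    simp only [hk] at this ⊢
    linarith
  -- Subtracting the nonnegative Green integral only lowers the positive part, so the growth
  -- condition on `p` alone suffices.
  · have hbd : ∀ t ∈ Ioo 0 T, ∀ x, ENNReal.ofReal (max (Real.exp (-k * t) * p x t
        - greenHeat d p0 x t) 0 * Real.exp (-a * x ^ 2)) ≤ ENNReal.ofReal (Real.exp (|k| * T))
        * ENNReal.ofReal (|p x t| * Real.exp (-a * x ^ 2)) := fun t ht x => by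
      rw [← ENNReal.ofReal_mul (Real.exp_nonneg _), ← mul_assoc]
      refine ENNReal.ofReal_le_ofReal ?_
      gcongr
      have hg := greenHeat_nonneg (d := d) (fun x => (hp0 x).le) x t
      refine max_le ?_ (by positivity)
      have : Real.exp (-k * t) * p x t ≤ Real.exp (|k| * T) * |p x t| := by
        gcongr
        · exact h.p_nonneg x t (Ioo_subset_Icc_self ht)
        · exact ht.1.le
        · exact neg_le_abs k
        · exact ht.2.le
        · exact le_abs_self _
      linarith
    refine lt_of_le_of_lt (setLIntegral_mono' measurableSet_Ioo fun t ht =>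
      lintegral_mono fun x => hbd t ht x) ?_
    simp_rw [lintegral_const_mul' _ _ ENNReal.ofReal_ne_top]
    exact ENNReal.mul_lt_top ENNReal.ofReal_lt_top hgr
  · intro x
    simp only [mul_zero, Real.exp_zero, one_mul, hadm.initial, hh.initial, sub_self, le_refl]

/-! ### Algebraic kernel bounds and large times -/

/-- Combines `e^{-s} ≤ 1 / (1 + s)` with `y² ≤ 2x² + 2(x - y)² = 2x² + 8 d t s`. -/
lemma greenKernel_mul_le {d t : ℝ} (hd : 0 < d) (ht : 0 < t) (x y : ℝ) :
    Real.exp (-(x - y) ^ 2 / (4 * d * t)) ≤ (1 + 2 * x ^ 2 + 8 * d) * (1 + t) * (1 + y ^ 2)⁻¹ := by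
  set s := (x - y) ^ 2 / (4 * d * t) with hs
  have hs0 : 0 ≤ s := by positivity
  have hst : (x - y) ^ 2 = 4 * d * t * s := by rw [hs]; field_simp
  have h1 : 1 + y ^ 2 ≤ (1 + 2 * x ^ 2 + 8 * d) * (1 + t) * (1 + s) := by
    have e : (1 + 2 * x ^ 2 + 8 * d) * (1 + t) * (1 + s) = 1 + 2 * x ^ 2 + 8 * d * t * s
      + ((1 + 2 * x ^ 2) * (t + s + t * s) + 8 * d * (1 + t + s)) := by ring
    have : 0 ≤ (1 + 2 * x ^ 2) * (t + s + t * s) + 8 * d * (1 + t + s) := by positivity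
    rw [e]
    nlinarith [sq_nonneg (2 * x - y)]
  have h2 : Real.exp (-(x - y) ^ 2 / (4 * d * t)) ≤ (1 + s)⁻¹ := by
    rw [neg_div, ← hs, Real.exp_neg]
    gcongr
    linarith [Real.add_one_le_exp s]
  refine h2.trans ?_
  rw [← div_eq_mul_inv, inv_eq_one_div, div_le_div_iff₀ (by positivity) (by positivity), one_mul]
  exact h1

lemma greenScale_le_one {d t : ℝ} (hd : 0 < d) (ht : 1 ≤ t) : greenScale d t ≤ greenScale d 1 := by
  unfold greenScale
  gcongr

/-- With the weaker weight `(1 + y²)^{-1/2}` the kernel loses only `√t`, which the normalization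
cancels. The bound is uniform in `t ≥ 1`, as dominated convergence requires. -/
lemma greenScale_mul_greenKernel_le {d t : ℝ} (hd : 0 < d) (ht : 1 ≤ t) (x y : ℝ) :
    greenScale d t * Real.exp (-(x - y) ^ 2 / (4 * d * t))
      ≤ greenScale d 1 * √(1 + 2 * x ^ 2 + 8 * d) * (√(1 + y ^ 2))⁻¹ := by
  have ht0 : 0 < t := by linarith
  set s := (x - y) ^ 2 / (4 * d * t) with hs
  have hs0 : 0 ≤ s := by positivity
  have hst : (x - y) ^ 2 = 4 * d * t * s := by rw [hs]; field_simp
  have h1 : √(1 + y ^ 2) ≤ √(1 + 2 * x ^ 2 + 8 * d) * √t * (1 + s) := by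
    rw [← Real.sqrt_mul (by positivity)]
    refine Real.sqrt_le_iff.2 ⟨by positivity, ?_⟩
    rw [mul_pow, Real.sq_sqrt (by positivity)]
    have e : (1 + 2 * x ^ 2 + 8 * d) * t * (1 + s) ^ 2 = t + 2 * x ^ 2 * t + 8 * d * t * s
      + ((1 + 2 * x ^ 2) * t * (2 * s + s ^ 2) + 8 * d * t * (1 + s + s ^ 2)) := by ring
    have h2 : 0 ≤ (1 + 2 * x ^ 2) * t * (2 * s + s ^ 2) + 8 * d * t * (1 + s + s ^ 2) := by
      positivity
    have h3 : x ^ 2 ≤ x ^ 2 * t := le_mul_of_one_le_right (sq_nonneg x) ht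
    rw [e]
    nlinarith [sq_nonneg (2 * x - y)]
  have h2 : Real.exp (-(x - y) ^ 2 / (4 * d * t)) ≤ (1 + s)⁻¹ := by
    rw [neg_div, ← hs, Real.exp_neg]
    gcongr
    linarith [Real.add_one_le_exp s]
  have h3 : greenScale d t = greenScale d 1 * (√t)⁻¹ := by
    rw [greenScale, greenScale, mul_one, Real.sqrt_mul (by positivity) t]
    have : √t ≠ 0 := by positivity
    have : √(Real.pi * d) ≠ 0 := by positivity
    field_simp
  rw [h3, mul_assoc (greenScale d 1) (√t)⁻¹, mul_assoc (greenScale d 1) (√(1 + 2 * x ^ 2 + 8 * d))]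
  refine mul_le_mul_of_nonneg_left ?_ (greenScale_nonneg d 1)
  calc (√t)⁻¹ * Real.exp (-(x - y) ^ 2 / (4 * d * t)) ≤ (√t)⁻¹ * (1 + s)⁻¹ := by gcongr
    _ ≤ √(1 + 2 * x ^ 2 + 8 * d) * (√(1 + y ^ 2))⁻¹ := by
      rw [← mul_inv, ← div_eq_mul_inv, inv_eq_one_div,
        div_le_div_iff₀ (by positivity) (by positivity), one_mul, ← mul_assoc]
      exact h1

lemma GreenConverges.of_integrable {d : ℝ} {g : ℝ → ℝ} (hd : 0 < d) (hg : Continuous g)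
    (h : Integrable fun y => g y * (1 + y ^ 2)⁻¹) (T : ℝ) : GreenConverges d T g := by
  intro x t ht
  refine (h.norm.const_mul ((1 + 2 * x ^ 2 + 8 * d) * (1 + t))).mono'
    (by fun_prop : Continuous fun y => Real.exp (-(x - y) ^ 2 / (4 * d * t)) * g
      y).aestronglyMeasurable (Eventually.of_forall fun y => ?_)
  rw [norm_mul, norm_mul, Real.norm_of_nonneg (Real.exp_nonneg _),
    Real.norm_of_nonneg (by positivity : 0 ≤ (1 + y ^ 2)⁻¹)]
  calc _ ≤ (1 + 2 * x ^ 2 + 8 * d) * (1 + t) * (1 + y ^ 2)⁻¹ * ‖g y‖ := by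
        gcongr; exact greenKernel_mul_le hd ht.1 x y
    _ = _ := by ring

lemma integrable_mul_inv_of_sqrt {g : ℝ → ℝ} (hg : Continuous g)
    (h : Integrable fun y => g y * (√(1 + y ^ 2))⁻¹) :
    Integrable fun y => g y * (1 + y ^ 2)⁻¹ := by
  have hc : Continuous fun y : ℝ => (1 + y ^ 2)⁻¹ :=
    Continuous.inv₀ (by fun_prop) fun y => by positivity
  refine h.mono (hg.mul hc).aestronglyMeasurable (Eventually.of_forall fun y => ?_)
  rw [norm_mul, norm_mul, Real.norm_of_nonneg (by positivity : 0 ≤ (1 + y ^ 2)⁻¹),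
    Real.norm_of_nonneg (by positivity : 0 ≤ (√(1 + y ^ 2))⁻¹)]
  gcongr
  exact Real.sqrt_le_iff.2 ⟨by positivity, by nlinarith [sq_nonneg y, sq_nonneg (y ^ 2)]⟩

lemma integrable_mul_inv_of_bddAbove {g : ℝ → ℝ} (hg : Continuous g) (hg0 : ∀ x, 0 ≤ g x)
    (h : BddAbove (range fun x : ℝ => ∫ y in x..(x + 1), g y)) :
    Integrable fun y => g y * (1 + y ^ 2)⁻¹ := by
  obtain ⟨M, hM⟩ := h
  have hM' : ∀ x, ∫ y in x..(x + 1), g y ≤ M := fun x => hM ⟨x, rfl⟩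
  have hc : Continuous fun y : ℝ => (1 + y ^ 2)⁻¹ :=
    Continuous.inv₀ (by fun_prop) fun y => by positivity
  have hi : ∀ n : ℤ, IntegrableOn (fun y => g y * (1 + y ^ 2)⁻¹) (Ioc (n : ℝ) (n + 1)) :=
    fun n => (hg.mul hc).integrableOn_Ioc
  rw [← integrableOn_univ, ← iUnion_Ioc_intCast ℝ]
  refine integrableOn_iUnion_of_summable_integral_norm hi ?_
  -- On `(n, n + 1]` the weight is at most `2 / (n + 1/2)²`; centring at the midpoint avoids a zero
  -- denominator for every integer `n`.
  have hsum := ((Real.summable_one_div_int_add_rpow (1 / 2) 2).2 (by norm_num)).mul_left (2 * M)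
  refine Summable.of_nonneg_of_le (fun n => integral_nonneg fun y => norm_nonneg _)
    (fun n => ?_) hsum
  have hne : (n : ℝ) + 1 / 2 ≠ 0 := by
    intro h0
    have : (2 * n + 1 : ℝ) = 0 := by linarith
    have : (2 * n + 1 : ℤ) = 0 := by exact_mod_cast this
    omega
  have hpos : 0 < |(n : ℝ) + 1 / 2| := abs_pos.2 hne
  set B := 1 / |(n : ℝ) + 1 / 2| ^ (2 : ℝ) with hB
  calc ∫ y in Ioc (n : ℝ) (n + 1), ‖g y * (1 + y ^ 2)⁻¹‖
      ≤ ∫ y in Ioc (n : ℝ) (n + 1), 2 * B * g y := by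
        refine setIntegral_mono_on (hi n).norm ((hg.integrableOn_Ioc).const_mul _)
          measurableSet_Ioc fun y hy => ?_
        rw [Real.norm_of_nonneg (mul_nonneg (hg0 y) (by positivity)), mul_comm]
        refine mul_le_mul_of_nonneg_right ?_ (hg0 y)
        rw [hB, Real.rpow_two, sq_abs, mul_one_div, inv_eq_one_div,
          div_le_div_iff₀ (by positivity) (by positivity)]
        nlinarith [hy.1, hy.2, mul_nonneg (sub_nonneg.2 hy.1.le) (sub_nonneg.2 hy.2),
          sq_nonneg ((n : ℝ) + 1 / 2 - 2 * y)]
    _ = 2 * B * ∫ y in (n : ℝ)..(n + 1), g y := by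
        rw [integral_const_mul, intervalIntegral.integral_of_le (by linarith)]
    _ ≤ 2 * B * M := by gcongr; exact hM' n
    _ = _ := by ring

lemma greenHeat_le_mul_one_add {d : ℝ} {g : ℝ → ℝ} (hd : 0 < d) (hg : Continuous g)
    (hg0 : ∀ x, 0 ≤ g x) (h : Integrable fun y => g y * (1 + y ^ 2)⁻¹) (x : ℝ) {t : ℝ}
    (ht : 1 ≤ t) :
    greenHeat d g x t ≤ greenScale d 1 * ((1 + 2 * x ^ 2 + 8 * d) *
      ∫ y, g y * (1 + y ^ 2)⁻¹) * (1 + t) := by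
  have ht0 : 0 < t := by linarith
  have hI : ∫ y, Real.exp (-(x - y) ^ 2 / (4 * d * t)) * g y
      ≤ ∫ y, (1 + 2 * x ^ 2 + 8 * d) * (1 + t) * (g y * (1 + y ^ 2)⁻¹) := by
    refine integral_mono (GreenConverges.of_integrable hd hg h t x t ⟨ht0, le_rfl⟩)
      (h.const_mul _) fun y => ?_
    calc _ ≤ (1 + 2 * x ^ 2 + 8 * d) * (1 + t) * (1 + y ^ 2)⁻¹ * g y :=
          mul_le_mul_of_nonneg_right (greenKernel_mul_le hd ht0 x y) (hg0 y)
      _ = _ := by ring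
  rw [integral_const_mul] at hI
  have h0 : 0 ≤ ∫ y, Real.exp (-(x - y) ^ 2 / (4 * d * t)) * g y :=
    integral_nonneg fun y => mul_nonneg (Real.exp_nonneg _) (hg0 y)
  rw [greenHeat_of_pos ht0]
  simp only [greenMoment, pow_zero, one_mul]
  calc _ ≤ greenScale d 1 * ((1 + 2 * x ^ 2 + 8 * d) * (1 + t) * ∫ y, g y * (1 + y ^ 2)⁻¹) :=
        mul_le_mul (greenScale_le_one hd ht) hI h0 (greenScale_nonneg _ _)
    _ = _ := by ring

lemma tendsto_greenScale_atTop {d : ℝ} (hd : 0 < d) : Tendsto (greenScale d) atTop (𝓝 0) := by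
  unfold greenScale
  refine tendsto_const_nhds.div_atTop (Tendsto.const_mul_atTop (by norm_num) ?_)
  exact Real.tendsto_sqrt_atTop.comp (Tendsto.const_mul_atTop (by positivity) tendsto_id)

/-- For each `y` the integrand tends to `0` with the normalization, and
`greenScale_mul_greenKernel_le` dominates it. -/
lemma tendsto_greenHeat_atTop {d : ℝ} {g : ℝ → ℝ} (hd : 0 < d) (hg : Continuous g)
    (h : Integrable fun y => g y * (√(1 + y ^ 2))⁻¹) (x : ℝ) :
    Tendsto (fun t => greenHeat d g x t) atTop (𝓝 0) := by
  have key : Tendsto (fun t => ∫ y, greenScale d t * Real.exp (-(x - y) ^ 2 / (4 * d * t)) * g y)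
      atTop (𝓝 (∫ _ : ℝ, (0 : ℝ))) := by
    refine tendsto_integral_filter_of_dominated_convergence
      (fun y => greenScale d 1 * √(1 + 2 * x ^ 2 + 8 * d) * ‖g y * (√(1 + y ^ 2))⁻¹‖) ?_ ?_
      (h.norm.const_mul _) ?_
    · exact Eventually.of_forall fun t => (by fun_prop : Continuous fun y =>
        greenScale d t * Real.exp (-(x - y) ^ 2 / (4 * d * t)) * g y).aestronglyMeasurable
    · filter_upwards [eventually_ge_atTop 1] with t ht
      refine Eventually.of_forall fun y => ?_
      rw [norm_mul, norm_mul (g y), Real.norm_of_nonneg (by positivity : 0 ≤ (√(1 + y ^ 2))⁻¹),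
        Real.norm_of_nonneg (mul_nonneg (greenScale_nonneg d t) (Real.exp_nonneg _))]
      calc _ ≤ greenScale d 1 * √(1 + 2 * x ^ 2 + 8 * d) * (√(1 + y ^ 2))⁻¹ * ‖g y‖ := by
            exact mul_le_mul_of_nonneg_right (greenScale_mul_greenKernel_le hd ht x y) (norm_nonneg _)
        _ = _ := by ring
    · refine Eventually.of_forall fun y => ?_
      refine squeeze_zero_norm' (a := fun t => greenScale d t * ‖g y‖) ?_ ?_
      · filter_upwards [eventually_gt_atTop 0] with t ht
        rw [norm_mul, Real.norm_of_nonneg (mul_nonneg (greenScale_nonneg d t) (Real.exp_nonneg _))]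
        gcongr
        refine mul_le_of_le_one_right (greenScale_nonneg d t) (Real.exp_le_one_iff.2 ?_)
        rw [neg_div, neg_nonpos]
        positivity
      · simpa using (tendsto_greenScale_atTop hd).mul_const ‖g y‖
  rw [integral_zero] at key
  refine key.congr' ?_
  filter_upwards [eventually_gt_atTop 0] with t ht
  rw [greenHeat_of_pos ht]
  simp only [greenMoment, pow_zero, one_mul, ← integral_const_mul, mul_assoc]

/-! ### The upper bound and the limits -/

theorem proposition8 (d η δ ρ θ : ℝ) (hd : 0 < d) (hη : 0 < η) (hδ : 0 < δ) (hρ : 0 < ρ)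
    (hθ : 0 < θ) (hθ' : θ ≤ 1) (p0 : ℝ → ℝ) (hp0 : ∀ x, 0 < p0 x) :
    -- the upper bound, for every horizon
    (∀ T : ℝ, 0 < T → ∀ (p u τ : ℝ → ℝ → ℝ) (τmin : ℝ),
      IsOptimalWithTax d η δ ρ θ T p0 p u τ τmin →
      (socialCost ρ θ T p u ≠ ⊤ ∨ GreenConverges d T p0) →
        GreenConverges d T p0 ∧ IsHeatSolution d T p0 (greenHeat d p0) ∧
        ∀ x, ∀ t ∈ Icc 0 T,
          p x t ≤ Real.exp ((η - δ - η * τmin) * t) * greenHeat d p0 x t) ∧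
    -- the limit, for optimal pairs indexed by the horizon
    (∀ (p u τ : ℝ → ℝ → ℝ → ℝ) (τmin : ℝ → ℝ),
      (∀ T : ℝ, 0 < T → IsOptimalWithTax d η δ ρ θ T p0 (p T) (u T) (τ T) (τmin T)) →
        -- finite social cost
        ((∀ T : ℝ, 0 < T → socialCost ρ θ T (p T) (u T) ≠ ⊤) →
          (∀ᶠ T in atTop, (η - δ) / η < τmin T) →
          ∀ x, Tendsto (fun T => p T x T) atTop (𝓝 0)) ∧
        -- social cost possibly infinite
        (BddAbove (range fun x : ℝ => ∫ y in x..(x + 1), p0 y) →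
          (∃ c : ℝ, (η - δ) / η < c ∧ ∀ᶠ T in atTop, c ≤ τmin T) →
          ∀ x, Tendsto (fun T => p T x T) atTop (𝓝 0))) := by
  have hcont : ∀ {T : ℝ} {p u τ : ℝ → ℝ → ℝ} {τmin : ℝ}, 0 < T →
      IsOptimalWithTax d η δ ρ θ T p0 p u τ τmin → Continuous p0 := fun hT h => by
    have := continuous_slice h.optimal.admissible.classical.cont ⟨le_rfl, hT.le⟩
    simpa only [h.optimal.admissible.initial] using this
  have part1 : ∀ T : ℝ, 0 < T → ∀ (p u τ : ℝ → ℝ → ℝ) (τmin : ℝ),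
      IsOptimalWithTax d η δ ρ θ T p0 p u τ τmin →
      (socialCost ρ θ T p u ≠ ⊤ ∨ GreenConverges d T p0) →
        GreenConverges d T p0 ∧ IsHeatSolution d T p0 (greenHeat d p0) ∧
        ∀ x, ∀ t ∈ Icc 0 T,
          p x t ≤ Real.exp ((η - δ - η * τmin) * t) * greenHeat d p0 x t := by
    intro T hT p u τ τmin h hor
    have hc := hcont hT h
    have hG : GreenConverges d T p0 := hor.elim (fun hfin =>
      GreenConverges.of_integrable hd hc (integrable_mul_inv_of_sqrt hc
        (h.optimal.admissible.integrable_initial hd hη hρ hT hp0 hc hfin)) T) id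
    have hh := hG.isHeatSolution hd hT hc
    exact ⟨hG, hh, fun x t ht => h.le_greenHeat hd hη hp0 hh x ht⟩
  refine ⟨part1, fun p u τ τmin hopt => ?_⟩
  have hc := hcont one_pos (hopt 1 one_pos)
  have hp : ∀ x, ∀ᶠ T in atTop, 0 ≤ p T x T := fun x => by
    filter_upwards [eventually_gt_atTop 0] with T hT
    exact (hopt T hT).p_nonneg x T ⟨hT.le, le_rfl⟩
  refine ⟨fun hfin hτ x => ?_, fun hbdd ⟨c, hc1, hτ⟩ x => ?_⟩
  -- The datum is common to all horizons, so its integrability can be taken from the horizon `1`.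
  · have hI := (hopt 1 one_pos).optimal.admissible.integrable_initial hd hη hρ one_pos hp0 hc
      (hfin 1 one_pos)
    refine squeeze_zero' (hp x) ?_ (tendsto_greenHeat_atTop hd hc hI x)
    filter_upwards [eventually_gt_atTop 0, hτ] with T hT hτT
    refine ((part1 T hT _ _ _ _ (hopt T hT) (Or.inl (hfin T hT))).2.2 x T ⟨hT.le, le_rfl⟩).trans ?_
    refine mul_le_of_le_one_left (greenHeat_nonneg (fun x => (hp0 x).le) x T)
      (Real.exp_le_one_iff.2 (mul_nonpos_of_nonpos_of_nonneg ?_ hT.le))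
    rw [div_lt_iff₀ hη] at hτT
    linarith
  · have hI := integrable_mul_inv_of_bddAbove hc (fun x => (hp0 x).le) hbdd
    set κ := η * c - (η - δ) with hκ
    have hκ0 : 0 < κ := by
      rw [div_lt_iff₀ hη] at hc1
      simp only [hκ]; linarith
    set A := greenScale d 1 * ((1 + 2 * x ^ 2 + 8 * d) * ∫ y, p0 y * (1 + y ^ 2)⁻¹) with hA
    -- The gap `κ > 0` is independent of `T`, so the exponential beats the linear bound of
    -- `greenHeat_le_mul_one_add`.
    have hlim : Tendsto (fun T : ℝ => Real.exp (-κ * T) * (A * (1 + T))) atTop (𝓝 0) := by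
      have h0 := (Real.tendsto_exp_comp_nhds_zero.2
        (tendsto_id.const_mul_atTop_of_neg (neg_lt_zero.2 hκ0)))
      have h1 := tendsto_rpow_mul_exp_neg_mul_atTop_nhds_zero 1 κ hκ0
      simp only [Real.rpow_one] at h1
      have h2 := (h0.add h1).const_mul A
      simp only [add_zero, mul_zero] at h2
      refine h2.congr fun T => ?_
      simp only [id]
      ring
    refine squeeze_zero' (hp x) ?_ hlim
    filter_upwards [eventually_ge_atTop 1, hτ] with T hT hτT
    have hT0 : 0 < T := by linarith
    refine ((part1 T hT0 _ _ _ _ (hopt T hT0)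
      (Or.inr (GreenConverges.of_integrable hd hc hI T))).2.2 x T ⟨hT0.le, le_rfl⟩).trans ?_
    refine mul_le_mul (Real.exp_le_exp.2 (mul_le_mul_of_nonneg_right ?_ hT0.le))
      (greenHeat_le_mul_one_add hd hc (fun x => (hp0 x).le) hI x hT)
      (greenHeat_nonneg (fun x => (hp0 x).le) x T) (Real.exp_nonneg _)
    have := mul_le_mul_of_nonneg_left hτT hη.le
    simp only [hκ]; linarith
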